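/- Let $K:[0,\infty)\to[0,\infty)$ satisfy (K1) $K$ is lower semicontinuous and non-decreasing, with $K(0)=0$; (K2) for every $M>0$ there is a constant $C_M>0$ such that $K(\rho_1)+K(\rho_2)\ge K(\rho_1+\rho_2)+C_M\rho_1\rho_2$ for all $\rho_1,\rho_2\ge 0$ with $\rho_1+\rho_2\le M$; (K3) $\lim_{\rho\downarrow 0}K(\rho)/\rho=1$. Let $a<b$ be real numbers and $\lambda>0$. Let $BV(a,b)$ be the space of integrable functions $u$ on $(a,b)$ whose distributional derivative $Du$ is a finite signed Radon measure on $(a,b)$; let $|Du|$ be its total variation measure, $J_u\subset(a,b)$ the (approximate) jump set of $u$, and $u^{+},u^{-}$ the one-sided traces of $u$. For $g\in C[a,b]$ and $u\in BV(a,b)$ set $$TV_K(u)=|Du|\big((a,b)\setminus J_u\big)+\sum_{x\in J_u}K\big(|u^{+}(x)-u^{-}(x)|\big),\qquad TV_{Kg}(u)=TV_K(u)+\frac{\lambda}{2}\int_a^b|u-g|^2\,dx .$$ Theorem. Let $K$ satisfy (K1)–(K3), and let $g\in C[a,b]$ be non-decreasing (resp. non-increasing). Let $M>0$ satisfy $M\ge|g(b)-g(a)|$,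 and let $C_M>0$ be any constant for which the inequality in (K2) holds for this $M$. Let $U\in BV(a,b)$ be a minimizer of $TV_{Kg}$ over $BV(a,b)$. Then $U$ coincides almost everywhere on $(a,b)$ with a function on $[a,b]$ that is non-decreasing (resp. non-increasing), is piecewise constant with finitely many pieces, and takes its values in $[\inf_{[a,b]}g,\ \sup_{[a,b]}g]$. Moreover, the number $m$ of jumps of $U$ (the cardinality of $J_U$) is finite and satisfies $$m\le\left[\frac{(b-a)\lambda}{2C_M}\right]+1,$$ where $[r]$ denotes the integer part of $r\ge 0$. -/

import Mathlib

open MeasureTheory Set Filter Topology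
open scoped NNReal ENNReal ContDiff

noncomputable section

namespace KWC

/-! ### The jump cost `K : [0,∞) → [0,∞)` -/

/-- (K1): `K` is lower semicontinuous and non-decreasing with `K 0 = 0`. -/
structure CondK1 (K : ℝ≥0 → ℝ≥0) : Prop where
  lsc : LowerSemicontinuous K
  mono : Monotone K
  zero : K 0 = 0

/-- The inequality of (K2) for a given bound `M` and a given constant `C`:
`K ρ₁ + K ρ₂ ≥ K (ρ₁ + ρ₂) + C ρ₁ ρ₂` whenever `ρ₁ + ρ₂ ≤ M`. -/
def IneqK2 (K : ℝ≥0 → ℝ≥0) (M C : ℝ≥0) : Prop :=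
  ∀ ρ₁ ρ₂ : ℝ≥0, ρ₁ + ρ₂ ≤ M → K ρ₁ + K ρ₂ ≥ K (ρ₁ + ρ₂) + C * ρ₁ * ρ₂

/-- (K2): for every `M > 0` the inequality holds with some constant `C > 0`. -/
def CondK2 (K : ℝ≥0 → ℝ≥0) : Prop :=
  ∀ M : ℝ≥0, 0 < M → ∃ C : ℝ≥0, 0 < C ∧ IneqK2 K M C

/-- (K3): `K ρ / ρ → 1` as `ρ ↓ 0`. -/
def CondK3 (K : ℝ≥0 → ℝ≥0) : Prop :=
  Tendsto (fun ρ : ℝ≥0 => K ρ / ρ) (𝓝[>] 0) (𝓝 1)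

/-! ### Functions of bounded variation on `(a, b)`

A function on `(a, b)` is represented by a function `ℝ → ℝ`; its values outside `(a, b)` and on
null sets play no role in any of the notions below. -/

/-- Integral of a function against a signed measure, through the Jordan decomposition. -/
def signedIntegral (μ : SignedMeasure ℝ) (φ : ℝ → ℝ) : ℝ :=
  (∫ x, φ x ∂μ.toJordanDecomposition.posPart) - ∫ x, φ x ∂μ.toJordanDecomposition.negPart

/-- The finite signed measure `μ`, carried by `(a, b)`, is the distributional derivative of `u`
on `(a, b)`. -/
structure HasDistribDeriv (a b : ℝ) (u : ℝ → ℝ) (μ : SignedMeasure ℝ) : Prop where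
  carried : μ.totalVariation (Ioo a b)ᶜ = 0
  integral_eq : ∀ φ : ℝ → ℝ, ContDiff ℝ ∞ φ → HasCompactSupport φ → tsupport φ ⊆ Ioo a b →
    ∫ x in Ioo a b, u x * deriv φ x = - signedIntegral μ φ

/-- `u ∈ BV(a, b)`: `u` is integrable on `(a, b)` and its distributional derivative is a finite
(signed) Radon measure. -/
structure IsBV (a b : ℝ) (u : ℝ → ℝ) : Prop where
  integrable : IntegrableOn u (Ioo a b)
  exists_deriv : ∃ μ : SignedMeasure ℝ, HasDistribDeriv a b u μ

open scoped Classical in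
/-- The distributional derivative `Du` of `u ∈ BV(a, b)` (`0` if `u` has none). -/
def distribDeriv (a b : ℝ) (u : ℝ → ℝ) : SignedMeasure ℝ :=
  if h : ∃ μ : SignedMeasure ℝ, HasDistribDeriv a b u μ then h.choose else 0

/-- `c` is the (approximate) trace of `u` at `x` from the left. -/
def HasLeftTrace (u : ℝ → ℝ) (x c : ℝ) : Prop :=
  Tendsto (fun r : ℝ => ⨍ y in Ioo (x - r) x, |u y - c|) (𝓝[>] 0) (𝓝 0)

/-- `c` is the (approximate) trace of `u` at `x` from the right. -/
def HasRightTrace (u : ℝ → ℝ) (x c : ℝ) : Prop :=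
  Tendsto (fun r : ℝ => ⨍ y in Ioo x (x + r), |u y - c|) (𝓝[>] 0) (𝓝 0)

open scoped Classical in
/-- The left trace `u⁻(x)` (`0` if there is none). -/
def leftTrace (u : ℝ → ℝ) (x : ℝ) : ℝ :=
  if h : ∃ c, HasLeftTrace u x c then h.choose else 0

open scoped Classical in
/-- The right trace `u⁺(x)` (`0` if there is none). -/
def rightTrace (u : ℝ → ℝ) (x : ℝ) : ℝ :=
  if h : ∃ c, HasRightTrace u x c then h.choose else 0

/-- The (approximate) jump set `J_u ⊆ (a, b)`. -/
def jumpSet (a b : ℝ) (u : ℝ → ℝ) : Set ℝ :=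
  {x | x ∈ Ioo a b ∧ ∃ p q : ℝ, p ≠ q ∧ HasLeftTrace u x p ∧ HasRightTrace u x q}

/-! ### The energy -/

/-- `TV_K(u) = |Du|((a, b) \ J_u) + ∑_{x ∈ J_u} K(|u⁺(x) - u⁻(x)|)`; the sum is the integral over
`J_u` with respect to the zero-dimensional Hausdorff (counting) measure. -/
def TVK (K : ℝ≥0 → ℝ≥0) (a b : ℝ) (u : ℝ → ℝ) : ℝ≥0∞ :=
  (distribDeriv a b u).totalVariation (Ioo a b \ jumpSet a b u) +
    ∑' x : jumpSet a b u, (K (nndist (rightTrace u x) (leftTrace u x)) : ℝ≥0∞)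

/-- `F(u) = (lam / 2) ∫ₐᵇ |u - g|² dx`. -/
def fidelity (lam : ℝ) (g : ℝ → ℝ) (a b : ℝ) (u : ℝ → ℝ) : ℝ≥0∞ :=
  ENNReal.ofReal (lam / 2) * ∫⁻ x in Ioo a b, ENNReal.ofReal (|u x - g x| ^ 2)

/-- `TV_{Kg}(u) = TV_K(u) + F(u)`. -/
def TVKg (K : ℝ≥0 → ℝ≥0) (lam : ℝ) (g : ℝ → ℝ) (a b : ℝ) (u : ℝ → ℝ) : ℝ≥0∞ :=
  TVK K a b u + fidelity lam g a b u

/-- `U ∈ BV(a, b)` minimizes `TV_{Kg}` over `BV(a, b)`. -/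
structure IsMinimizer (K : ℝ≥0 → ℝ≥0) (lam : ℝ) (g : ℝ → ℝ) (a b : ℝ) (U : ℝ → ℝ) : Prop where
  isBV : IsBV a b U
  le : ∀ v : ℝ → ℝ, IsBV a b v → TVKg K lam g a b U ≤ TVKg K lam g a b v

/-- `v` is piecewise constant on `(a, b)` with finitely many pieces: there is a subdivision
`a = t₀ < t₁ < ⋯ < tₙ₊₁ = b` such that `v` is constant on each open piece `(tᵢ, tᵢ₊₁)`. -/
def IsPiecewiseConstant (a b : ℝ) (v : ℝ → ℝ) : Prop :=
  ∃ (n : ℕ) (t : Fin (n + 2) → ℝ) (c : Fin (n + 1) → ℝ), StrictMono t ∧ t 0 = a ∧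
    t (Fin.last (n + 1)) = b ∧ ∀ i : Fin (n + 1), ∀ x ∈ Ioo (t i.castSucc) (t i.succ), v x = c i

end KWC

end

noncomputable section

namespace KWC

/-! ### Consequences of (K1)–(K3) -/

/-! By subadditivity and `K ρ / ρ → 1`, `K |x - y|` is a metric on the line dominated by the usual
one, so every function has a variation `kVar` in this metric. For `U` of bounded variation with
derivative `μ`, the right-continuous representative `u = c + μ (Iic ·)` satisfies `kVar u ≤ TVK U`
(`HasDistribDeriv.kVar_le_TVK`). Conversely, sampling a bounded `w` with countably many
discontinuities gives step functions with `TVK ≤ kVar w` whose fidelity tends to that of `w`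
(`exists_step_approx`, `IsMinimizer.le_kVar_add`). Hence `u` minimizes `kVar` plus fidelity among
such functions, and competitors may be built and compared pointwise.

Let `g` be non-decreasing. Truncating `u` at a level `c` on one side of a point never increases the
variation, and improves the fidelity when `g` lies on the right side of `c`. This makes `u` monotone
with values in `[g a, g b]`.

Now let `t - s < 2C/λ`, `p = u s`, `q = u t`. Replace `u` on `[s, t]` by a single jump from `p` to
`q` where `g` crosses `(p + q)/2`. With `D = (q - u)(u - p)`, the fidelity grows by at most `(λ/2) ∫
D`, while (K2) saves at least `C D(x)` of variation for every `x`. Minimality gives `C D(x) ≤ (λ/2)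
∫ D`; integrating over the short interval forces `∫ D = 0`, hence `D = 0` everywhere: `u` takes only
the values `p` and `q` (`IsTameMinimizer.eq_or_eq`). Two discontinuities are therefore at least
`2C/λ` apart, and `u` is constant between consecutive ones. Non-increasing data reduce to this case
by a change of sign. -/

/-- The properties of a jump cost that make `K |x - y|` a metric dominated by the usual one. -/
class IsCost (K : ℝ≥0 → ℝ≥0) : Prop where
  mono : Monotone K
  zero : K 0 = 0
  subadd : ∀ x y, K (x + y) ≤ K x + K y
  le_self : ∀ x, K x ≤ x

theorem IsCost.of_cond {K : ℝ≥0 → ℝ≥0} (h1 : CondK1 K) (h2 : CondK2 K) (h3 : CondK3 K) :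
    IsCost K := by
  have sub : ∀ x y, K (x + y) ≤ K x + K y := by
    intro x y
    obtain ⟨C, -, hC⟩ := h2 (x + y + 1) (by positivity)
    exact le_trans le_self_add (hC x y le_self_add)
  refine ⟨h1.mono, h1.zero, sub, fun x => ?_⟩
  rcases eq_or_ne x 0 with rfl | hx
  · simp [h1.zero]
  have hx0 : 0 < x := pos_iff_ne_zero.2 hx
  -- Halving the argument does not decrease `K x / x`, by subadditivity; by (K3) the quotients along
  -- `x / 2 ^ n` tend to 1.
  have key : ∀ n : ℕ, K x / x ≤ K (x / 2 ^ n) / (x / 2 ^ n) := by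
    intro n
    induction n with
    | zero => simp
    | succ n ih =>
      refine ih.trans ?_
      have h := sub (x / 2 ^ (n + 1)) (x / 2 ^ (n + 1))
      have e : x / 2 ^ (n + 1) + x / 2 ^ (n + 1) = x / 2 ^ n := by
        rw [pow_succ]; field_simp; norm_num
      rw [e] at h
      rw [div_le_div_iff₀ (by positivity) (by positivity)]
      calc K (x / 2 ^ n) * (x / 2 ^ (n + 1))
          ≤ (K (x / 2 ^ (n + 1)) + K (x / 2 ^ (n + 1))) * (x / 2 ^ (n + 1)) := by gcongr
        _ = K (x / 2 ^ (n + 1)) * (x / 2 ^ n) := by rw [← e]; ring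
  have lim : Tendsto (fun n : ℕ => x / 2 ^ n) atTop (𝓝[>] 0) := by
    rw [tendsto_nhdsWithin_iff]
    refine ⟨?_, Eventually.of_forall fun n => by simp only [mem_Ioi]; positivity⟩
    have h := (NNReal.tendsto_pow_atTop_nhds_zero_of_lt_one (r := (1 / 2 : ℝ≥0)) (by
      rw [div_lt_one] <;> norm_num)).const_mul x
    simpa [div_eq_mul_inv] using h
  have h := ge_of_tendsto (h3.comp lim) (Eventually.of_forall key)
  rwa [div_le_one hx0] at h

/-! ### Variation with respect to the metric `K |x - y|` -/

/-- The real line with the metric `K |x - y|`. -/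
def KLine (_K : ℝ≥0 → ℝ≥0) : Type := ℝ

instance (K : ℝ≥0 → ℝ≥0) [IsCost K] : PseudoEMetricSpace (KLine K) where
  edist := fun x y : ℝ => (K (nndist x y) : ℝ≥0∞)
  edist_self := fun x : ℝ => by
    have h : K (nndist x x) = 0 := by rw [nndist_self, IsCost.zero (K := K)]
    exact congrArg _ h
  edist_comm := fun x y : ℝ => by
    have h : K (nndist x y) = K (nndist y x) := by rw [nndist_comm]
    exact congrArg _ h
  edist_triangle := fun x y z : ℝ => by
    have h : K (nndist x z) ≤ K (nndist x y) + K (nndist y z) :=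
      (IsCost.mono (nndist_triangle x y z)).trans (IsCost.subadd _ _)
    exact (ENNReal.coe_le_coe.2 h).trans_eq (ENNReal.coe_add _ _)

/-- The variation of `w` on `s` for the metric `K |x - y|`. -/
def kVar (K : ℝ≥0 → ℝ≥0) [IsCost K] (w : ℝ → ℝ) (s : Set ℝ) : ℝ≥0∞ :=
  eVariationOn (E := KLine K) w s

section kVar

variable {K : ℝ≥0 → ℝ≥0} [IsCost K] {w u : ℝ → ℝ} {s t : Set ℝ}

theorem kVar_sum_le {n : ℕ} {p : ℕ → ℝ} (hp : Monotone p) (hs : ∀ i, p i ∈ s) :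
    ∑ i ∈ Finset.range n, (K (nndist (w (p (i + 1))) (w (p i))) : ℝ≥0∞) ≤ kVar K w s :=
  eVariationOn.sum_le (E := KLine K) (f := w) hp hs

theorem kVar_le {B : ℝ≥0∞} (h : ∀ (n : ℕ) (p : ℕ → ℝ), Monotone p → (∀ i, p i ∈ s) →
    ∑ i ∈ Finset.range n, (K (nndist (w (p (i + 1))) (w (p i))) : ℝ≥0∞) ≤ B) :
    kVar K w s ≤ B :=
  iSup_le fun ⟨n, p, hp, hs⟩ => h n p hp hs

theorem le_kVar {x y : ℝ} (hx : x ∈ s) (hy : y ∈ s) :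
    (K (nndist (w x) (w y)) : ℝ≥0∞) ≤ kVar K w s :=
  eVariationOn.edist_le (E := KLine K) w hx hy

theorem kVar_le_of_contraction
    (h : ∀ x ∈ s, ∀ y ∈ s, |w x - w y| ≤ |u x - u y|) : kVar K w s ≤ kVar K u s := by
  refine kVar_le fun n p hp hs => (Finset.sum_le_sum fun i _ => ?_).trans (kVar_sum_le hp hs)
  have : nndist (w (p (i + 1))) (w (p i)) ≤ nndist (u (p (i + 1))) (u (p i)) := by
    rw [← NNReal.coe_le_coe, coe_nndist, coe_nndist]
    exact h _ (hs _) _ (hs _)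
  exact_mod_cast IsCost.mono this

theorem kVar_congr (h : EqOn w u s) : kVar K w s = kVar K u s :=
  eVariationOn.congr (E := KLine K) h

theorem kVar_neg : kVar K (fun x => -w x) s = kVar K w s := by
  refine le_antisymm (kVar_le_of_contraction fun x _ y _ => le_of_eq ?_)
    (kVar_le_of_contraction fun x _ y _ => le_of_eq ?_) <;>
  rw [neg_sub_neg, abs_sub_comm]

theorem kVar_union {x : ℝ} (hs : IsGreatest s x) (ht : IsLeast t x) :
    kVar K w (s ∪ t) = kVar K w s + kVar K w t :=
  eVariationOn.union (E := KLine K) w hs ht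

theorem kVar_Ioo_split {a b z : ℝ} (hz : z ∈ Ioo a b) :
    kVar K w (Ioo a b) = kVar K w (Ioc a z) + kVar K w (Ico z b) := by
  rw [← Ioc_union_Ico_eq_Ioo hz.1 hz.2]
  exact kVar_union (isGreatest_Ioc hz.1) (isLeast_Ico hz.2)

theorem kVar_Ioo_split₂ {a b y z : ℝ} (hy : a < y) (hyz : y ≤ z) (hz : z < b) :
    kVar K w (Ioo a b) = kVar K w (Ioc a y) + kVar K w (Icc y z) + kVar K w (Ico z b) := by
  rw [kVar_Ioo_split ⟨hy.trans_le hyz, hz⟩, ← Ioc_union_Icc_eq_Ioc hy hyz,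
    kVar_union (isGreatest_Ioc hy) (isLeast_Icc hyz)]

theorem add_le_kVar_Icc {x y z : ℝ} (hx : x ∈ Icc y z) :
    (K (nndist (w y) (w x)) : ℝ≥0∞) + K (nndist (w x) (w z)) ≤ kVar K w (Icc y z) := by
  rw [← Icc_union_Icc_eq_Icc hx.1 hx.2, kVar_union (isGreatest_Icc hx.1) (isLeast_Icc hx.2)]
  exact add_le_add (le_kVar ⟨le_rfl, hx.1⟩ ⟨hx.1, le_rfl⟩) (le_kVar ⟨le_rfl, hx.2⟩ ⟨hx.2, le_rfl⟩)

/-- A function jumping once, from `p` to `q`, has variation at most `K |p - q|`. -/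
theorem kVar_ite_le {χ : ℝ → Prop} [DecidablePred χ] {p q : ℝ}
    (hχ : ∀ x ∈ s, ∀ y ∈ s, x ≤ y → χ x → χ y)
    (hw : ∀ x ∈ s, w x = if χ x then q else p) :
    kVar K w s ≤ (K (nndist q p) : ℝ≥0∞) := by
  refine kVar_le fun n r hr hs => ?_
  -- The sharper bound makes the induction close: the partial sum is still zero as long as `χ` has
  -- not been reached, so the jump is paid for once.
  have : ∑ i ∈ Finset.range n, (K (nndist (w (r (i + 1))) (w (r i))) : ℝ≥0∞) ≤
      if χ (r n) then (K (nndist q p) : ℝ≥0∞) else 0 := by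
    induction n with
    | zero => simp
    | succ n ih =>
      rw [Finset.sum_range_succ, hw _ (hs _), hw _ (hs _)]
      by_cases h : χ (r n)
      · have h' := hχ _ (hs n) _ (hs (n + 1)) (hr n.le_succ) h
        simpa [h, h', IsCost.zero] using ih
      · rw [if_neg h] at ih
        rw [nonpos_iff_eq_zero.1 ih, zero_add]
        by_cases h' : χ (r (n + 1)) <;> simp [h, h', IsCost.zero]
  refine this.trans ?_
  split_ifs <;> simp

end kVar

/-! ### The reduced minimization problem -/

/-- Bounded functions on `(a, b)` with countably many discontinuities. -/
structure Tame (a b : ℝ) (w : ℝ → ℝ) : Prop where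
  bdd : ∃ B, ∀ x ∈ Ioo a b, |w x| ≤ B
  countable : {x ∈ Ioo a b | ¬ContinuousAt w x}.Countable

theorem Tame.neg {a b : ℝ} {w : ℝ → ℝ} (h : Tame a b w) : Tame a b fun x => -w x := by
  obtain ⟨B, hB⟩ := h.bdd
  refine ⟨⟨B, fun x hx => by simpa using hB x hx⟩,
    h.countable.mono ?_⟩
  rintro x ⟨hx, hn⟩
  exact ⟨hx, fun hc => hn hc.neg⟩

theorem Tame.aemeasurable {a b : ℝ} {w : ℝ → ℝ} (h : Tame a b w) :
    AEMeasurable w (volume.restrict (Ioo a b)) := by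
  set D := {x ∈ Ioo a b | ¬ContinuousAt w x} with hD
  have hm : MeasurableSet (Ioo a b \ D) := measurableSet_Ioo.diff h.countable.measurableSet
  have hc : ContinuousOn w (Ioo a b \ D) := fun x hx =>
    ContinuousAt.continuousWithinAt (by by_contra hc; exact hx.2 ⟨hx.1, hc⟩)
  have h1 := hc.aemeasurable (μ := volume) hm
  rwa [Measure.restrict_congr_set (μ := volume)
    (sdiff_null_ae_eq_self (h.countable.measure_zero volume))] at h1

theorem Tame.sub_sq_integrableOn {a b : ℝ} {w g : ℝ → ℝ} (h : Tame a b w)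
    (hg : ContinuousOn g (Icc a b)) : IntegrableOn (fun x => (w x - g x) ^ 2) (Ioo a b) := by
  obtain ⟨B, hB⟩ := h.bdd
  obtain ⟨G, hG⟩ := isCompact_Icc.exists_bound_of_continuousOn hg
  refine IntegrableOn.of_bound (by simp) ?_ ((B + G) ^ 2) ?_
  · have := (hg.mono Ioo_subset_Icc_self).aemeasurable (μ := volume) measurableSet_Ioo
    exact ((h.aemeasurable.sub this).pow_const 2).aestronglyMeasurable
  · refine (ae_restrict_iff' measurableSet_Ioo).2 (Eventually.of_forall fun x hx => ?_)
    have h1 := hB x hx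
    have h2 := hG x (Ioo_subset_Icc_self hx)
    rw [Real.norm_eq_abs] at h2 ⊢
    rw [abs_of_nonneg (sq_nonneg _), sq_le_sq]
    exact (abs_sub _ _).trans ((add_le_add h1 h2).trans (le_abs_self _))

/-- The right-continuous function `u` minimizes the sum of the `K`-variation and the fidelity among
all tame functions. -/
structure IsTameMinimizer (K : ℝ≥0 → ℝ≥0) [IsCost K] (lam : ℝ) (g : ℝ → ℝ) (a b : ℝ) (u : ℝ → ℝ) :
    Prop where
  tame : Tame a b u
  rightCont : ∀ x ∈ Ioo a b, ContinuousWithinAt u (Ici x) x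
  finite : kVar K u (Ioo a b) ≠ ⊤
  le : ∀ w, Tame a b w →
    kVar K u (Ioo a b) + ENNReal.ofReal (lam / 2 * ∫ x in Ioo a b, (u x - g x) ^ 2) ≤
      kVar K w (Ioo a b) + ENNReal.ofReal (lam / 2 * ∫ x in Ioo a b, (w x - g x) ^ 2)

section

variable {K : ℝ≥0 → ℝ≥0} [IsCost K] {lam a b : ℝ} {g u w : ℝ → ℝ}

theorem IsTameMinimizer.neg (h : IsTameMinimizer K lam g a b u) :
    IsTameMinimizer K lam (fun x => -g x) a b fun x => -u x where
  tame := h.tame.neg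
  rightCont x hx := (h.rightCont x hx).neg
  finite := by rw [kVar_neg]; exact h.finite
  le w hw := by
    have := h.le _ hw.neg
    rw [kVar_neg] at this ⊢
    have e1 : ∀ x, (-w x - g x) ^ 2 = (w x - -g x) ^ 2 := fun x => by ring
    have e2 : ∀ x, (-u x - -g x) ^ 2 = (u x - g x) ^ 2 := fun x => by ring
    simpa only [e1, e2] using this

/-- The basic trade-off at a minimizer: variation saved is at most fidelity lost. The variation of
`w` is finite, being below that of `u`, so it can be cancelled. -/
theorem IsTameMinimizer.gain_le (h : IsTameMinimizer K lam g a b u) (hlam : 0 < lam)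
    (hg : ContinuousOn g (Icc a b)) (hw : Tame a b w) {d : ℝ} (hd : 0 ≤ d)
    (hle : kVar K w (Ioo a b) + ENNReal.ofReal d ≤ kVar K u (Ioo a b)) :
    d ≤ lam / 2 * ∫ x in Ioo a b, ((w x - g x) ^ 2 - (u x - g x) ^ 2) := by
  rw [integral_sub (hw.sub_sq_integrableOn hg) (h.tame.sub_sq_integrableOn hg)]
  have hF : ∀ v : ℝ → ℝ, 0 ≤ lam / 2 * ∫ x in Ioo a b, (v x - g x) ^ 2 := fun v =>
    mul_nonneg (by positivity) (integral_nonneg fun x => sq_nonneg _)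
  have h1 := (add_le_add_left hle _).trans (h.le w hw)
  have hwt : kVar K w (Ioo a b) ≠ ⊤ := ne_top_of_le_ne_top h.finite (le_self_add.trans hle)
  rw [add_assoc, ENNReal.add_le_add_iff_left hwt, ← ENNReal.ofReal_add hd (hF u),
    ENNReal.ofReal_le_ofReal_iff (hF w)] at h1
  linarith

/-- If a competitor has no more variation and is pointwise at least as close to the data, then it is
almost everywhere exactly as close. -/
theorem IsTameMinimizer.ae_eq (h : IsTameMinimizer K lam g a b u) (hlam : 0 < lam)
    (hg : ContinuousOn g (Icc a b)) (hw : Tame a b w)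
    (hle : kVar K w (Ioo a b) ≤ kVar K u (Ioo a b))
    (hpt : ∀ x ∈ Ioo a b, (w x - g x) ^ 2 ≤ (u x - g x) ^ 2) :
    ∀ᵐ x, x ∈ Ioo a b → (u x - g x) ^ 2 ≤ (w x - g x) ^ 2 := by
  have h1 := h.gain_le hlam hg hw le_rfl (by simpa using hle)
  have hi := (h.tame.sub_sq_integrableOn hg).sub (hw.sub_sq_integrableOn hg)
  have hn : 0 ≤ᵐ[volume.restrict (Ioo a b)]
      ((fun x => (u x - g x) ^ 2) - fun x => (w x - g x) ^ 2) :=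
    (ae_restrict_iff' measurableSet_Ioo).2 (Eventually.of_forall fun x hx =>
      sub_nonneg.2 (hpt x hx))
  have h2 : ∫ x in Ioo a b, ((w x - g x) ^ 2 - (u x - g x) ^ 2) = -∫ x in Ioo a b,
      ((fun x => (u x - g x) ^ 2) - fun x => (w x - g x) ^ 2) x := by
    rw [← integral_neg]; simp
  have h3 : ∫ x in Ioo a b, ((fun x => (u x - g x) ^ 2) - fun x => (w x - g x) ^ 2) x = 0 := by
    refine le_antisymm ?_ (integral_nonneg_of_ae hn)
    rw [h2] at h1
    nlinarith
  have h4 := (integral_eq_zero_iff_of_nonneg_ae hn hi).1 h3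
  filter_upwards [(ae_restrict_iff' measurableSet_Ioo).1 h4] with x hx hxs
  have := hx hxs
  simp only [Pi.sub_apply, Pi.zero_apply] at this
  linarith

/-- A right-continuous function that is almost everywhere `≤ c` on an open interval is `≤ c` there. -/
theorem le_of_ae_le_of_rightCont {α β c : ℝ} (hr : ∀ x ∈ Ioo α β, ContinuousWithinAt u (Ici x) x)
    (h : ∀ᵐ x, x ∈ Ioo α β → u x ≤ c) : ∀ x ∈ Ioo α β, u x ≤ c := by
  intro x hx
  by_contra! hc
  have h1 : ∀ᶠ y in 𝓝[≥] x, c < u y := (hr x hx).eventually (lt_mem_nhds hc)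
  have h2 : ∀ᶠ y in 𝓝[>] x, c < u y ∧ y ∈ Ioo α β :=
    (h1.filter_mono (nhdsWithin_mono x Ioi_subset_Ici_self)).and
      (mem_nhdsWithin_of_mem_nhds (isOpen_Ioo.mem_nhds hx))
  obtain ⟨d, hd, hsub⟩ := mem_nhdsGT_iff_exists_Ioo_subset.1 h2
  have h0 : volume (Ioo x d) = 0 := by
    refine measure_mono_null (fun y hy => ?_) (ae_iff.1 h)
    obtain ⟨h3, h4⟩ := hsub hy
    exact fun h5 => (h5 h4).not_gt h3
  rw [Real.volume_Ioo, ENNReal.ofReal_eq_zero] at h0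
  have : x < d := hd
  linarith

/-! ### Truncation: monotonicity and range of minimizers -/

theorem tame_ite_lt {v : ℝ → ℝ} (hu : Tame a b u) (hv : Tame a b v) (z : ℝ) :
    Tame a b fun x => if x < z then u x else v x := by
  obtain ⟨B, hB⟩ := hu.bdd
  obtain ⟨B', hB'⟩ := hv.bdd
  refine ⟨⟨max B B', fun x hx => ?_⟩, ?_⟩
  · split_ifs
    · exact (hB x hx).trans (le_max_left _ _)
    · exact (hB' x hx).trans (le_max_right _ _)
  · refine ((hu.countable.union hv.countable).union (countable_singleton z)).mono ?_
    rintro x ⟨hx, hc⟩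
    by_contra hn
    simp only [mem_union, mem_ofPred_eq, mem_singleton_iff, not_or, not_and, not_not] at hn
    obtain ⟨⟨h1, h2⟩, h3⟩ := hn
    rcases lt_or_gt_of_ne h3 with h | h
    · exact hc ((h1 hx).congr (by filter_upwards [gt_mem_nhds h] with y hy; simp [hy]))
    · exact hc ((h2 hx).congr (by filter_upwards [lt_mem_nhds h] with y hy; simp [hy.le]))

theorem Tame.min_const (hu : Tame a b u) (c : ℝ) : Tame a b fun x => min (u x) c := by
  obtain ⟨B, hB⟩ := hu.bdd
  refine ⟨⟨max B |c|, fun x hx => ?_⟩, hu.countable.mono ?_⟩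
  · exact (abs_min_le_max_abs_abs).trans (max_le_max_right _ (hB x hx))
  · rintro x ⟨hx, hn⟩
    exact ⟨hx, fun hc => hn (hc.min continuousAt_const)⟩

theorem Tame.max_const (hu : Tame a b u) (c : ℝ) : Tame a b fun x => max (u x) c := by
  obtain ⟨B, hB⟩ := hu.bdd
  refine ⟨⟨max B |c|, fun x hx => ?_⟩, hu.countable.mono ?_⟩
  · exact (abs_max_le_max_abs_abs).trans (max_le_max_right _ (hB x hx))
  · rintro x ⟨hx, hn⟩
    exact ⟨hx, fun hc => hn (hc.max continuousAt_const)⟩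

/-- Replace `u` by `min u c` to the left of `z`. Since `u z ≤ c`, the competitor agrees with `u` at
`z`, so the variation splits there and truncation, a contraction, does not increase it. Where `u > c
≥ g` the truncation is strictly closer to `g`; minimality makes this set null and right continuity
makes it empty. At `z = b` there is nothing to match, which is why the condition on `u z` is
conditional. -/
theorem IsTameMinimizer.le_left (h : IsTameMinimizer K lam g a b u) (hlam : 0 < lam)
    (hg : ContinuousOn g (Icc a b)) {c z : ℝ} (haz : a < z) (hzb : z ≤ b)
    (hz : z < b → u z ≤ c) (hgc : ∀ x ∈ Ioo a z, g x ≤ c) : ∀ x ∈ Ioo a z, u x ≤ c := by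
  set w : ℝ → ℝ := fun x => if x < z then min (u x) c else u x with hwdef
  have hw : Tame a b w := tame_ite_lt (h.tame.min_const c) h.tame z
  have hcon : ∀ S, (∀ x ∈ S, w x = min (u x) c) → kVar K w S ≤ kVar K u S := by
    intro S hS
    refine kVar_le_of_contraction fun x hx y hy => ?_
    rw [hS x hx, hS y hy]
    simpa using abs_min_sub_min_le_max (u x) c (u y) c
  have hlt : ∀ x, x < z → w x = min (u x) c := fun x hx => if_pos hx
  have hge : ∀ x, z ≤ x → w x = u x := fun x hx => if_neg hx.not_gt
  have hle : kVar K w (Ioo a b) ≤ kVar K u (Ioo a b) := by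
    rcases hzb.eq_or_lt with rfl | hzb
    · exact hcon _ fun x hx => hlt x hx.2
    · rw [kVar_Ioo_split ⟨haz, hzb⟩, kVar_Ioo_split ⟨haz, hzb⟩]
      refine add_le_add (hcon _ fun x hx => ?_) (kVar_congr fun x hx => hge x hx.1).le
      rcases hx.2.eq_or_lt with rfl | hxz
      · rw [hge x le_rfl, min_eq_left (hz hzb)]
      · exact hlt x hxz
  have hae := h.ae_eq hlam hg hw hle (fun x hx => by
    rcases lt_or_ge x z with hxz | hxz
    · rw [hlt x hxz]
      have := hgc x ⟨hx.1, hxz⟩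
      rcases le_total (u x) c with h' | h'
      · rw [min_eq_left h']
      · rw [min_eq_right h']; nlinarith
    · rw [hge x hxz])
  refine le_of_ae_le_of_rightCont (fun x hx => h.rightCont x ⟨hx.1, hx.2.trans_le hzb⟩) ?_
  filter_upwards [hae] with x hx hxs
  have h1 := hx ⟨hxs.1, hxs.2.trans_le hzb⟩
  by_contra! hc
  rw [hlt x hxs.2, min_eq_right hc.le] at h1
  nlinarith [hgc x hxs]

theorem IsTameMinimizer.le_right (h : IsTameMinimizer K lam g a b u) (hlam : 0 < lam)
    (hg : ContinuousOn g (Icc a b)) {c z : ℝ} (haz : a ≤ z) (hzb : z < b)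
    (hz : a < z → c ≤ u z) (hgc : ∀ x ∈ Ioo z b, c ≤ g x) : ∀ x ∈ Ioo z b, c ≤ u x := by
  set w : ℝ → ℝ := fun x => if x < z then u x else max (u x) c with hwdef
  have hw : Tame a b w := tame_ite_lt h.tame (h.tame.max_const c) z
  have hcon : ∀ S, (∀ x ∈ S, w x = max (u x) c) → kVar K w S ≤ kVar K u S := by
    intro S hS
    refine kVar_le_of_contraction fun x hx y hy => ?_
    rw [hS x hx, hS y hy]
    simpa using abs_max_sub_max_le_max (u x) c (u y) c
  have hlt : ∀ x, x < z → w x = u x := fun x hx => if_pos hx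
  have hge : ∀ x, z ≤ x → w x = max (u x) c := fun x hx => if_neg hx.not_gt
  have hle : kVar K w (Ioo a b) ≤ kVar K u (Ioo a b) := by
    rcases haz.eq_or_lt with rfl | haz
    · exact hcon _ fun x hx => hge x hx.1.le
    · rw [kVar_Ioo_split ⟨haz, hzb⟩, kVar_Ioo_split ⟨haz, hzb⟩]
      refine add_le_add (kVar_congr fun x hx => ?_).le (hcon _ fun x hx => hge x hx.1)
      rcases hx.2.eq_or_lt with rfl | hxz
      · rw [hge x le_rfl, max_eq_left (hz haz)]
      · exact hlt x hxz
  have hae := h.ae_eq hlam hg hw hle (fun x hx => by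
    rcases le_or_gt x z with hxz | hxz
    · rcases hxz.eq_or_lt with rfl | hxz
      · rw [hge x le_rfl, max_eq_left (hz hx.1)]
      · rw [hlt x hxz]
    · rw [hge x hxz.le]
      have := hgc x ⟨hxz, hx.2⟩
      rcases le_total (u x) c with h' | h'
      · rw [max_eq_right h']; nlinarith
      · rw [max_eq_left h'])
  -- The mirrored bound is obtained by applying the right-continuity lemma to `-u`.
  have key := le_of_ae_le_of_rightCont (u := fun x => -u x) (α := z) (β := b) (c := -c)
    (fun x hx => (h.rightCont x ⟨haz.trans_lt hx.1, hx.2⟩).neg) (by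
      filter_upwards [hae] with x hx hxs
      have h1 := hx ⟨haz.trans_lt hxs.1, hxs.2⟩
      by_contra! hc
      rw [hge x hxs.1.le, max_eq_right (by linarith)] at h1
      nlinarith [hgc x hxs])
  exact fun x hx => neg_le_neg_iff.1 (key x hx)

/-- Suppose `u y < c < u x` with `x < y`. If some `z` in between, or an endpoint, has `g z = c`, or
`g` stays on one side of `c`, one of the two truncations applies: to the left of `z` if `u z` and `g
z` are at most `c`, contradicting `c < u x`, and to the right if both are at least `c`,
contradicting `u y < c`. Continuity of `g` supplies `z`. -/
theorem IsTameMinimizer.monotoneOn (h : IsTameMinimizer K lam g a b u) (hlam : 0 < lam)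
    (hg : ContinuousOn g (Icc a b)) (hmono : MonotoneOn g (Icc a b)) :
    MonotoneOn u (Ioo a b) := by
  intro x hx y hy hxy
  by_contra! hlt
  have hxy : x < y := hxy.lt_of_ne (by rintro rfl; exact lt_irrefl _ hlt)
  obtain ⟨c, hc1, hc2⟩ := exists_between hlt
  have left : ∀ z ∈ Ioo a b, x < z → u z ≤ c → g z ≤ c → False := fun z hz hxz huz hgz =>
    (h.le_left hlam hg hz.1 hz.2.le (fun _ => huz) (fun t ht =>
      (hmono ⟨ht.1.le, (ht.2.trans hz.2).le⟩ (Ioo_subset_Icc_self hz) ht.2.le).trans hgz)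
      x ⟨hx.1, hxz⟩).not_gt hc2
  have right : ∀ z ∈ Ioo a b, z < y → c ≤ u z → c ≤ g z → False := fun z hz hzy huz hgz =>
    (h.le_right hlam hg hz.1.le hz.2 (fun _ => huz) (fun t ht =>
      hgz.trans (hmono (Ioo_subset_Icc_self hz) ⟨(hz.1.trans ht.1).le, ht.2.le⟩ ht.1.le))
      y ⟨hzy, hy.2⟩).not_gt hc1
  by_cases h1 : g y ≤ c
  · exact left y hy hxy hc1.le h1
  by_cases h2 : c ≤ g x
  · exact right x hx hxy hc2.le h2
  push Not at h1 h2
  obtain ⟨z, hz, rfl⟩ := intermediate_value_Ioo hxy.le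
    (hg.mono (Icc_subset_Icc hx.1.le hy.2.le)) ⟨h2, h1⟩
  have hzab : z ∈ Ioo a b := ⟨hx.1.trans hz.1, hz.2.trans hy.2⟩
  rcases le_total (u z) (g z) with h3 | h3
  · exact left z hzab hz.1 h3 le_rfl
  · exact right z hzab hz.2 h3 le_rfl

/-- Truncation over the whole interval, at the levels `g a` and `g b`. -/
theorem IsTameMinimizer.mem_Icc (h : IsTameMinimizer K lam g a b u) (hlam : 0 < lam) (hab : a < b)
    (hg : ContinuousOn g (Icc a b)) (hmono : MonotoneOn g (Icc a b)) :
    ∀ x ∈ Ioo a b, u x ∈ Icc (g a) (g b) := fun x hx =>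
  ⟨h.le_right hlam hg le_rfl hab (fun h => absurd h (lt_irrefl a)) (fun _ ht =>
      hmono (left_mem_Icc.2 hab.le) (Ioo_subset_Icc_self ht) ht.1.le) x hx,
    h.le_left hlam hg hab le_rfl (fun h => absurd h (lt_irrefl b)) (fun _ ht =>
      hmono (Ioo_subset_Icc_self ht) (right_mem_Icc.2 hab.le) ht.2.le) x hx⟩

end

/-! ### Merging jumps: the two-value property on short intervals -/

theorem IneqK2.gain {K : ℝ≥0 → ℝ≥0} {M C : ℝ≥0} (h : IneqK2 K M C) {p y q : ℝ} (hpy : p ≤ y) (hyq : y ≤ q)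
    (hM : q - p ≤ M) :
    (K (nndist q p) : ℝ≥0∞) + ENNReal.ofReal (C * ((q - y) * (y - p))) ≤
      K (nndist p y) + K (nndist y q) := by
  have e : nndist p y + nndist y q = nndist q p := by
    rw [← NNReal.coe_inj, NNReal.coe_add, coe_nndist, coe_nndist, coe_nndist, Real.dist_eq,
      Real.dist_eq, Real.dist_eq, abs_of_nonpos (by linarith), abs_of_nonpos (by linarith),
      abs_of_nonneg (by linarith)]
    ring
  have hM' : nndist p y + nndist y q ≤ M := by
    rw [e, ← NNReal.coe_le_coe, coe_nndist, Real.dist_eq, abs_of_nonneg (by linarith)]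
    exact hM
  have h1 := h _ _ hM'
  rw [e] at h1
  have e2 : ENNReal.ofReal (C * ((q - y) * (y - p))) =
      ((C * nndist p y * nndist y q : ℝ≥0) : ℝ≥0∞) := by
    rw [← ENNReal.ofReal_coe_nnreal]
    congr 1
    rw [NNReal.coe_mul, NNReal.coe_mul, coe_nndist, coe_nndist, Real.dist_eq,
      Real.dist_eq, abs_of_nonpos (by linarith), abs_of_nonpos (by linarith)]
    ring
  rw [e2]
  exact_mod_cast h1

section

variable {K : ℝ≥0 → ℝ≥0} [IsCost K] {lam a b : ℝ} {g u w : ℝ → ℝ}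

theorem tame_of_monotoneOn {c d : ℝ} (hw : MonotoneOn w (Ioo a b))
    (hm : ∀ x ∈ Ioo a b, w x ∈ Icc c d) : Tame a b w := by
  refine ⟨⟨max |c| |d|, fun x hx => abs_le_max_abs_abs (hm x hx).1 (hm x hx).2⟩, ?_⟩
  refine hw.countable_not_continuousWithinAt.mono ?_
  rintro x ⟨hx, hc⟩
  exact ⟨hx, fun h => hc (h.continuousAt (isOpen_Ioo.mem_nhds hx))⟩

/-- Between nearby points a monotone minimizer takes only its two extreme values. -/
theorem IsTameMinimizer.eq_or_eq (h : IsTameMinimizer K lam g a b u) (hlam : 0 < lam) (hab : a < b)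
    (hg : ContinuousOn g (Icc a b)) (hmono : MonotoneOn g (Icc a b)) {M C : ℝ≥0}
    (hgM : g b - g a ≤ M) (hC : 0 < C) (hCM : IneqK2 K M C) {s t : ℝ} (hs : a < s) (ht : t < b)
    (hst : s < t) (hlen : t - s < 2 * C / lam) : ∀ x ∈ Icc s t, u x = u s ∨ u x = u t := by
  have hu := h.monotoneOn hlam hg hmono
  have hur := h.mem_Icc hlam hab hg hmono
  have hsab : s ∈ Ioo a b := ⟨hs, hst.trans ht⟩
  have htab : t ∈ Ioo a b := ⟨hs.trans hst, ht⟩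
  have hsub : Icc s t ⊆ Ioo a b := Icc_subset_Ioo hs ht
  have hsub' : Ioo s t ⊆ Ioo a b := Ioo_subset_Icc_self.trans hsub
  set p := u s with hp
  set q := u t with hq
  have hpq : p ≤ q := hu hsab htab hst.le
  have hup : ∀ x ∈ Icc s t, p ≤ u x := fun x hx => hu hsab (hsub hx) hx.1
  have huq : ∀ x ∈ Icc s t, u x ≤ q := fun x hx => hu (hsub hx) htab hx.2
  have hCr : (0 : ℝ) < C := hC
  -- The competitor jumps where `g` exceeds the midpoint of `p` and `q`. The clauses on `s` and `t`
  -- force the values `p` at `s` and `q` at `t` whatever `g` does, so it glues to `u` at both ends.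
  set χ : ℝ → Prop := fun x => s < x ∧ (t ≤ x ∨ (p + q) / 2 < g x) with hχ
  classical
  set w : ℝ → ℝ := fun x => if x < s ∨ t < x then u x else if χ x then q else p with hwdef
  have hwm : ∀ x ∈ Icc s t, w x = if χ x then q else p := fun x hx =>
    if_neg (by rw [not_or, not_lt, not_lt]; exact hx)
  have hwl : ∀ x ≤ s, w x = u x := by
    intro x hx
    rcases hx.eq_or_lt with rfl | hx
    · rw [hwm _ (left_mem_Icc.2 hst.le), if_neg (fun h => lt_irrefl _ h.1)]
    · exact if_pos (Or.inl hx)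
  have hwr : ∀ x, t ≤ x → w x = u x := by
    intro x hx
    rcases hx.eq_or_lt with rfl | hx
    · rw [hwm _ (right_mem_Icc.2 hst.le), if_pos ⟨hst, Or.inl le_rfl⟩]
    · exact if_pos (Or.inr hx)
  have hχm : ∀ x ∈ Icc s t, ∀ y ∈ Icc s t, x ≤ y → χ x → χ y := by
    rintro x hx y hy hxy ⟨h1, h2⟩
    refine ⟨h1.trans_le hxy, h2.imp (fun h => h.trans hxy) fun h => h.trans_le ?_⟩
    exact hmono (Ioo_subset_Icc_self (hsub hx)) (Ioo_subset_Icc_self (hsub hy)) hxy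
  have hwpq : ∀ x ∈ Icc s t, w x ∈ Icc p q := by
    intro x hx
    rw [hwm x hx]
    split_ifs
    · exact ⟨hpq, le_rfl⟩
    · exact ⟨le_rfl, hpq⟩
  have hwmono : MonotoneOn w (Ioo a b) := by
    intro x hx y hy hxy
    rcases le_total x s with h1 | h1
    · rw [hwl x h1]
      rcases le_total y s with h2 | h2
      · rw [hwl y h2]; exact hu hx hy hxy
      rcases le_total y t with h3 | h3
      · exact (hu hx hsab h1).trans (hwpq y ⟨h2, h3⟩).1
      · rw [hwr y h3]; exact hu hx hy hxy
    rcases le_total x t with h2 | h2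
    · rcases le_total y t with h3 | h3
      · have hx' : x ∈ Icc s t := ⟨h1, h2⟩
        have hy' : y ∈ Icc s t := ⟨h1.trans hxy, h3⟩
        by_cases hc : χ x
        · rw [hwm x hx', hwm y hy', if_pos hc, if_pos (hχm x hx' y hy' hxy hc)]
        · rw [hwm x hx', if_neg hc]; exact (hwpq y hy').1
      · rw [hwr y h3]; exact (hwpq x ⟨h1, h2⟩).2.trans (hu htab hy h3)
    · rw [hwr x h2, hwr y (h2.trans hxy)]; exact hu hx hy hxy
  have hw : Tame a b w := by
    refine tame_of_monotoneOn (c := g a) (d := g b) hwmono fun x hx => ?_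
    rcases le_total x s with h1 | h1
    · rw [hwl x h1]; exact hur x hx
    rcases le_total x t with h2 | h2
    · exact Icc_subset_Icc (hur s hsab).1 (hur t htab).2 (hwpq x ⟨h1, h2⟩)
    · rw [hwr x h2]; exact hur x hx
  set D : ℝ → ℝ := fun x => (q - u x) * (u x - p) with hD
  have hD0 : ∀ x ∈ Icc s t, 0 ≤ D x := fun x hx =>
    mul_nonneg (sub_nonneg.2 (huq x hx)) (sub_nonneg.2 (hup x hx))
  have hDint : IntegrableOn D (Ioo s t) := by
    refine IntegrableOn.of_bound (by simp) ?_ ((q - p) * (q - p)) ?_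
    · have := h.tame.aemeasurable.mono_measure (Measure.restrict_mono_set volume hsub')
      exact ((aemeasurable_const.sub this).mul (this.sub aemeasurable_const)).aestronglyMeasurable
    · refine (ae_restrict_iff' measurableSet_Ioo).2 (Eventually.of_forall fun x hx => ?_)
      have hx := Ioo_subset_Icc_self hx
      rw [Real.norm_eq_abs, abs_of_nonneg (hD0 x hx)]
      exact mul_le_mul (by linarith [hup x hx]) (by linarith [huq x hx])
        (by linarith [hup x hx]) (by linarith)
  set I := ∫ x in Ioo s t, D x with hI
  -- If `w = q` and `g > (p + q)/2`, then `(q - g)² - (u - g)² = (q - u)(q + u - 2g) ≤ (q - u)(u -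
  -- p)`; the case `w = p` is symmetric.
  have hcost : ∫ x in Ioo a b, ((w x - g x) ^ 2 - (u x - g x) ^ 2) ≤ I := by
    rw [hI, ← inter_eq_right.2 hsub', ← setIntegral_indicator measurableSet_Ioo]
    refine setIntegral_mono_on ((hw.sub_sq_integrableOn hg).sub (h.tame.sub_sq_integrableOn hg))
      ?_ measurableSet_Ioo fun x hx => ?_
    · exact ((integrable_indicator_iff measurableSet_Ioo).2 hDint).integrableOn
    · by_cases hxs : x ∈ Ioo s t
      · rw [indicator_of_mem hxs, hwm x (Ioo_subset_Icc_self hxs)]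
        have h1 := hup x (Ioo_subset_Icc_self hxs)
        have h2 := huq x (Ioo_subset_Icc_self hxs)
        simp only [hD]
        by_cases hc : (p + q) / 2 < g x
        · rw [if_pos ⟨hxs.1, Or.inr hc⟩]
          nlinarith
        · rw [if_neg (fun h => h.2.elim (fun h => hxs.2.not_ge h) hc)]
          nlinarith
      · rw [indicator_of_notMem hxs]
        have : w x = u x := by
          rcases le_or_gt x s with h1 | h1
          · exact hwl x h1
          · exact hwr x (by by_contra! h2; exact hxs ⟨h1, h2⟩)
        rw [this, sub_self]
  -- The saving in variation holds with any single `x` as intermediate point, while the cost is the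
  -- same integral for all `x`.
  have hgain : ∀ x ∈ Icc s t, C * D x ≤ lam / 2 * I := by
    intro x hx
    refine (h.gain_le hlam hg hw (mul_nonneg hCr.le (hD0 x hx)) ?_).trans
      (mul_le_mul_of_nonneg_left hcost (by positivity))
    rw [kVar_Ioo_split₂ hs hst.le ht, kVar_Ioo_split₂ hs hst.le ht,
      kVar_congr (w := w) (u := u) (s := Ioc a s) fun x hx => hwl x hx.2,
      kVar_congr (w := w) (u := u) (s := Ico t b) fun x hx => hwr x hx.1, add_right_comm,
      add_assoc (kVar K u (Ioc a s))]
    refine add_le_add (add_le_add le_rfl ?_) le_rfl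
    have hM : q - p ≤ M := by linarith [(hur s hsab).1, (hur t htab).2]
    exact (add_le_add (kVar_ite_le hχm hwm) le_rfl).trans
      ((hCM.gain (hup x hx) (huq x hx) hM).trans (add_le_kVar_Icc hx))
  have hI0 : 0 ≤ I := setIntegral_nonneg measurableSet_Ioo fun x hx =>
    hD0 x (Ioo_subset_Icc_self hx)
  -- Integrating the pointwise bound gives `I ≤ θ I` with `θ = λ (t - s) / (2C) < 1`, hence `I = 0`;
  -- the pointwise bound then yields `D x = 0` at every point, not merely almost everywhere.
  have hIle : I ≤ lam / 2 * I / C * (t - s) := by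
    have h1 : I ≤ ∫ _ in Ioo s t, lam / 2 * I / C :=
      setIntegral_mono_on hDint (integrableOn_const (by simp)) measurableSet_Ioo fun x hx => by
        rw [le_div_iff₀ hCr, mul_comm]
        exact hgain x (Ioo_subset_Icc_self hx)
    rw [setIntegral_const, Real.volume_real_Ioo_of_le hst.le, smul_eq_mul] at h1
    linarith
  have hIz : I = 0 := by
    by_contra hne
    have hpos : 0 < I := lt_of_le_of_ne hI0 (Ne.symm hne)
    have h1 : lam / 2 * I / C * (t - s) < lam / 2 * I / C * (2 * C / lam) :=
      mul_lt_mul_of_pos_left hlen (by positivity)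
    have h2 : lam / 2 * I / C * (2 * C / lam) = I := by field_simp
    linarith
  intro x hx
  have h1 := hgain x hx
  rw [hIz, mul_zero] at h1
  have h2 : D x = 0 := le_antisymm (by nlinarith) (hD0 x hx)
  rcases mul_eq_zero.1 h2 with h3 | h3
  · right; linarith
  · left; linarith

end

/-! ### Locally two-valued functions -/

/-- Any two discontinuities of a locally two-valued function are far apart. -/
theorem le_sub_of_eq_or_eq {a b δ : ℝ} {u : ℝ → ℝ}
    (h : ∀ s t, a < s → t < b → s < t → t - s < δ → ∀ x ∈ Icc s t, u x = u s ∨ u x = u t)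
    (hu : MonotoneOn u (Ioo a b)) {x y : ℝ} (hx : x ∈ Ioo a b ∧ ¬ContinuousAt u x)
    (hy : y ∈ Ioo a b ∧ ¬ContinuousAt u y) (hxy : x < y) : δ ≤ y - x := by
  by_contra! hlt
  -- The margin `e` leaves room on both sides: `t - s < (y - x) + 2e < δ`.
  obtain ⟨e, he0, he⟩ : ∃ e, 0 < e ∧ e < (δ - (y - x)) / 2 := exists_between (by linarith)
  obtain ⟨s, hs1, hs2⟩ : ∃ s, max a (x - e) < s ∧ s < x :=
    exists_between (max_lt hx.1.1 (by linarith))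
  obtain ⟨t, ht1, ht2⟩ : ∃ t, y < t ∧ t < min b (y + e) :=
    exists_between (lt_min hy.1.2 (by linarith))
  obtain ⟨r, hr1, hr2⟩ := exists_between hxy
  rw [max_lt_iff] at hs1
  rw [lt_min_iff] at ht2
  have const : ∀ α β, s ≤ α → β ≤ t → u α = u β → ∀ z ∈ Ioo α β, ContinuousAt u z := by
    intro α β hα hβ heq z hz
    have hIoo : ∀ z', α ≤ z' → z' ≤ β → z' ∈ Ioo a b := fun z' h1 h2 =>
      ⟨by linarith, by linarith⟩
    have : u =ᶠ[𝓝 z] fun _ => u α := by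
      filter_upwards [isOpen_Ioo.mem_nhds hz] with z' hz'
      exact le_antisymm
        ((hu (hIoo _ hz'.1.le hz'.2.le) (hIoo _ (hz.1.trans hz.2).le le_rfl) hz'.2.le).trans_eq
          heq.symm)
        (hu (hIoo _ le_rfl (hz.1.trans hz.2).le) (hIoo _ hz'.1.le hz'.2.le) hz'.1.le)
    exact continuousAt_const.congr this.symm
  -- If `u r = u s`, monotonicity makes `u` constant around `x`; if `u r = u t`, it is constant
  -- around `y`.
  rcases h s t hs1.1 ht2.1 (by linarith) (by linarith) r ⟨by linarith, by linarith⟩ with h1 | h1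
  · exact hx.2 (const s r le_rfl (by linarith) h1.symm x ⟨hs2, hr1⟩)
  · exact hy.2 (const r t (by linarith) le_rfl h1 y ⟨hr2, ht1⟩)

/-- Near `x` only two values are available, and continuity excludes, close to `x`, any of them that
differs from `u x`. -/
theorem eventually_eq_of_eq_or_eq {a b δ : ℝ} (hδ : 0 < δ) {u : ℝ → ℝ}
    (h : ∀ s t, a < s → t < b → s < t → t - s < δ → ∀ x ∈ Icc s t, u x = u s ∨ u x = u t)
    {x : ℝ} (hx : x ∈ Ioo a b) (hc : ContinuousAt u x) : ∀ᶠ y in 𝓝 x, u y = u x := by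
  obtain ⟨s, hs1, hs2⟩ : ∃ s, max a (x - δ / 2) < s ∧ s < x :=
    exists_between (max_lt hx.1 (by linarith))
  obtain ⟨t, ht1, ht2⟩ : ∃ t, x < t ∧ t < min b (x + δ / 2) :=
    exists_between (lt_min hx.2 (by linarith))
  rw [max_lt_iff] at hs1
  rw [lt_min_iff] at ht2
  have key := h s t hs1.1 ht2.1 (by linarith) (by linarith)
  have far : ∀ c, ∀ᶠ y in 𝓝 x, u y = c → u x = c := by
    intro c
    by_cases hxc : u x = c
    · exact Eventually.of_forall fun _ _ => hxc
    · filter_upwards [hc.eventually_ne hxc] with y hy hyc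
      exact absurd hyc hy
  filter_upwards [far (u s), far (u t), isOpen_Ioo.mem_nhds (⟨hs2, ht1⟩ : x ∈ Ioo s t)]
    with y h1 h2 h3
  rcases key y (Ioo_subset_Icc_self h3) with h4 | h4
  · rw [h4, h1 h4]
  · rw [h4, h2 h4]

theorem exists_const_of_eq_or_eq {a b δ : ℝ} (hδ : 0 < δ) {u : ℝ → ℝ}
    (h : ∀ s t, a < s → t < b → s < t → t - s < δ → ∀ x ∈ Icc s t, u x = u s ∨ u x = u t)
    {α β : ℝ} (hα : a ≤ α) (hβ : β ≤ b) (hc : ∀ x ∈ Ioo α β, ContinuousAt u x) :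
    ∃ c, ∀ x ∈ Ioo α β, u x = c := by
  have ev : ∀ x ∈ Ioo α β, u =ᶠ[𝓝 x] fun _ => u x := fun x hx =>
    eventually_eq_of_eq_or_eq hδ h ⟨hα.trans_lt hx.1, hx.2.trans_le hβ⟩ (hc x hx)
  refine isOpen_Ioo.exists_is_const_of_deriv_eq_zero isPreconnected_Ioo (𝕜 := ℝ) (fun x hx => ?_)
    fun x hx => ?_
  · exact ((differentiableAt_const (u x)).congr_of_eventuallyEq (ev x hx)).differentiableWithinAt
  · rw [(ev x hx).deriv_eq]; simp

/-- A subset of `(a, b)` whose points are `δ`-separated has at most `⌊(b - a) / δ⌋ + 1` points. -/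
theorem encard_le_of_separated {a b δ : ℝ} (hδ : 0 < δ) {J : Set ℝ} (hJ : J ⊆ Ioo a b)
    (h : ∀ x ∈ J, ∀ y ∈ J, x < y → δ ≤ y - x) :
    J.encard ≤ ((⌊(b - a) / δ⌋₊ + 1 : ℕ) : ℕ∞) := by
  -- Cut the interval into cells of length `δ` starting at `a`; separated points lie in distinct
  -- cells.
  have inj : InjOn (fun x => ⌊(x - a) / δ⌋₊) J := by
    have key : ∀ x ∈ J, ∀ y ∈ J, x < y → ⌊(x - a) / δ⌋₊ ≠ ⌊(y - a) / δ⌋₊ := by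
      intro x hx y hy hxy heq
      have h0 : ∀ z ∈ J, 0 ≤ (z - a) / δ := fun z hz =>
        div_nonneg (sub_nonneg.2 (hJ hz).1.le) hδ.le
      have h1 := Nat.floor_le (h0 x hx)
      have h2 := Nat.lt_floor_add_one ((y - a) / δ)
      rw [← heq] at h2
      have h3 : (y - a) / δ - (x - a) / δ = (y - x) / δ := by ring
      have h4 : 1 ≤ (y - x) / δ := (one_le_div hδ).2 (h x hx y hy hxy)
      linarith
    intro x hx y hy hxy
    by_contra hne
    rcases lt_or_gt_of_ne hne with hlt | hlt
    · exact key x hx y hy hlt hxy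
    · exact key y hy x hx hlt hxy.symm
  rw [← inj.encard_image]
  have hsub : (fun x => ⌊(x - a) / δ⌋₊) '' J ⊆ (Finset.range (⌊(b - a) / δ⌋₊ + 1) : Set ℕ) := by
    rintro _ ⟨x, hx, rfl⟩
    rw [Finset.coe_range, mem_Iio, Nat.lt_succ_iff]
    have := (hJ hx).2
    exact Nat.floor_le_floor (by gcongr)
  refine (encard_le_encard hsub).trans ?_
  rw [encard_coe_eq_coe_finsetCard, Finset.card_range]

theorem isPiecewiseConstant_of_finite {a b : ℝ} (hab : a < b) {v : ℝ → ℝ} {J : Set ℝ}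
    (hJ : J.Finite) (hsub : J ⊆ Ioo a b)
    (h : ∀ α β, a ≤ α → β ≤ b → (∀ x ∈ Ioo α β, x ∉ J) → ∃ c, ∀ x ∈ Ioo α β, v x = c) :
    IsPiecewiseConstant a b v := by
  classical
  -- The subdivision is the increasing enumeration of `J` together with the two endpoints, so no
  -- point of `J` lies strictly between consecutive nodes.
  set S : Finset ℝ := insert a (insert b hJ.toFinset) with hS
  have hbJ : b ∉ hJ.toFinset := fun hb => lt_irrefl b (hsub (hJ.mem_toFinset.1 hb)).2
  have haJ : a ∉ insert b hJ.toFinset := by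
    rw [Finset.mem_insert, not_or]
    exact ⟨hab.ne, fun ha => lt_irrefl a (hsub (hJ.mem_toFinset.1 ha)).1⟩
  have hcard : S.card = hJ.toFinset.card + 2 := by
    rw [hS, Finset.card_insert_of_notMem haJ, Finset.card_insert_of_notMem hbJ]
  have hmem : ∀ x ∈ S, x ∈ Icc a b := by
    intro x hx
    simp only [hS, Finset.mem_insert, Finite.mem_toFinset] at hx
    rcases hx with rfl | rfl | hx
    · exact left_mem_Icc.2 hab.le
    · exact right_mem_Icc.2 hab.le
    · exact Ioo_subset_Icc_self (hsub hx)
  set t := S.orderEmbOfFin hcard with ht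
  have hlt : ∀ i : Fin (hJ.toFinset.card + 1), ∀ x ∈ Ioo (t i.castSucc) (t i.succ), x ∉ J := by
    intro i x hx hxJ
    have hxS : x ∈ S := by simp [hS, hxJ]
    obtain ⟨j, rfl⟩ : x ∈ range t := by rw [ht, Finset.range_orderEmbOfFin]; exact hxS
    have h1 := t.lt_iff_lt.1 hx.1
    have h2 := t.lt_iff_lt.1 hx.2
    exact absurd h2 (not_lt.2 (Fin.castSucc_lt_iff_succ_le.1 h1))
  have hti : ∀ i, t i ∈ Icc a b := fun i => hmem _ (Finset.orderEmbOfFin_mem S hcard i)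
  choose c hc using fun i => h (t i.castSucc) (t (Fin.succ i)) (hti _).1 (hti _).2 (hlt i)
  refine ⟨hJ.toFinset.card, t, c, t.strictMono, ?_, ?_, hc⟩
  · obtain ⟨j, hj⟩ : a ∈ range t := by rw [ht, Finset.range_orderEmbOfFin]; simp [hS]
    exact le_antisymm ((t.monotone (Fin.zero_le j)).trans_eq hj) (hti _).1
  · obtain ⟨j, hj⟩ : b ∈ range t := by rw [ht, Finset.range_orderEmbOfFin]; simp [hS]
    exact le_antisymm (hti _).2 (hj.symm.trans_le (t.monotone (Fin.le_last j)))

/-- Minimizers of the reduced problem with monotone data are monotone step functions. -/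
theorem IsTameMinimizer.structure_of_monotoneOn {K : ℝ≥0 → ℝ≥0} [IsCost K] {lam a b : ℝ}
    {g u : ℝ → ℝ} (h : IsTameMinimizer K lam g a b u) (hlam : 0 < lam) (hab : a < b)
    (hg : ContinuousOn g (Icc a b)) (hmono : MonotoneOn g (Icc a b)) {M C : ℝ≥0}
    (hgM : g b - g a ≤ M) (hC : 0 < C) (hCM : IneqK2 K M C) :
    (∃ v : ℝ → ℝ, EqOn v u (Ioo a b) ∧ IsPiecewiseConstant a b v ∧ MonotoneOn v (Icc a b) ∧
      ∀ x ∈ Icc a b, v x ∈ Icc (g a) (g b)) ∧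
    {x ∈ Ioo a b | ¬ContinuousAt u x}.encard ≤
      ((⌊(b - a) * lam / (2 * (C : ℝ))⌋₊ + 1 : ℕ) : ℕ∞) := by
  have hCr : (0 : ℝ) < C := hC
  have hδ : 0 < 2 * C / lam := by positivity
  have hu := h.monotoneOn hlam hg hmono
  have hur := h.mem_Icc hlam hab hg hmono
  have hgab : g a ≤ g b := hmono (left_mem_Icc.2 hab.le) (right_mem_Icc.2 hab.le) hab.le
  have key := fun s t hs ht hst hlen =>
    h.eq_or_eq hlam hab hg hmono hgM hC hCM (s := s) (t := t) hs ht hst hlen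
  set J := {x ∈ Ioo a b | ¬ContinuousAt u x} with hJ
  have hJsub : J ⊆ Ioo a b := sep_subset _ _
  have hcard : J.encard ≤ ((⌊(b - a) * lam / (2 * (C : ℝ))⌋₊ + 1 : ℕ) : ℕ∞) := by
    rw [← div_div_eq_mul_div]
    exact encard_le_of_separated hδ hJsub fun x hx y hy hxy =>
      le_sub_of_eq_or_eq key hu hx hy hxy
  have hfin : J.Finite := by
    rw [← encard_lt_top_iff]
    exact hcard.trans_lt (ENat.natCast_lt_top _)
  -- The endpoint values `g a` and `g b` are the extremes of the range, so monotonicity extends to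
  -- the closed interval.
  set v : ℝ → ℝ := fun x => if x ≤ a then g a else if b ≤ x then g b else u x with hv
  have hvu : EqOn v u (Ioo a b) := fun x hx => by
    simp only [hv]
    rw [if_neg hx.1.not_ge, if_neg hx.2.not_ge]
  have hva : v a = g a := if_pos le_rfl
  have hvb : v b = g b := by
    simp only [hv]
    rw [if_neg hab.not_ge, if_pos le_rfl]
  have hvr : ∀ x ∈ Icc a b, v x ∈ Icc (g a) (g b) := by
    intro x hx
    rcases eq_endpoints_or_mem_Ioo_of_mem_Icc hx with rfl | rfl | hx
    · rw [hva]; exact left_mem_Icc.2 hgab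
    · rw [hvb]; exact right_mem_Icc.2 hgab
    · rw [hvu hx]; exact hur x hx
  refine ⟨⟨v, hvu, ?_, ?_, hvr⟩, hcard⟩
  · refine isPiecewiseConstant_of_finite hab hfin hJsub fun α β hα hβ hno => ?_
    obtain ⟨c, hc⟩ := exists_const_of_eq_or_eq hδ key hα hβ fun x hx => by
      by_contra hn
      exact hno x hx ⟨⟨hα.trans_lt hx.1, hx.2.trans_le hβ⟩, hn⟩
    exact ⟨c, fun x hx => (hvu ⟨hα.trans_lt hx.1, hx.2.trans_le hβ⟩).trans (hc x hx)⟩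
  · intro x hx y hy hxy
    rcases eq_endpoints_or_mem_Ioo_of_mem_Icc hx with rfl | rfl | hx'
    · rw [hva]; exact (hvr y hy).1
    · rw [le_antisymm hy.2 hxy]
    rcases eq_endpoints_or_mem_Ioo_of_mem_Icc hy with rfl | rfl | hy'
    · rw [le_antisymm hxy hx.1]
    · rw [hvb]; exact (hvr x hx).2
    · rw [hvu hx', hvu hy']; exact hu hx' hy' hxy

/-! ### Signed measures on the line -/

theorem tendsto_signedMeasure_of_indicator {ι : Type*} {L : Filter ι} [L.IsCountablyGenerated]
    (μ : SignedMeasure ℝ) {S : ι → Set ℝ} {A : Set ℝ} (hA : MeasurableSet A)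
    (hS : ∀ i, MeasurableSet (S i)) (h : ∀ x, ∀ᶠ i in L, x ∈ S i ↔ x ∈ A) :
    Tendsto (fun i => μ (S i)) L (𝓝 (μ A)) := by
  simp_rw [μ.apply_eq_posPart_real_sub_negPart_real hA,
    fun i => μ.apply_eq_posPart_real_sub_negPart_real (hS i)]
  exact ((ENNReal.tendsto_toReal (measure_ne_top _ _)).comp
      (tendsto_measure_of_ae_tendsto_indicator_of_isFiniteMeasure L hA hS (ae_of_all _ h))).sub
    ((ENNReal.tendsto_toReal (measure_ne_top _ _)).comp
      (tendsto_measure_of_ae_tendsto_indicator_of_isFiniteMeasure L hA hS (ae_of_all _ h)))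

theorem tendsto_Iic_right (μ : SignedMeasure ℝ) (x : ℝ) :
    Tendsto (fun y => μ (Iic y)) (𝓝[≥] x) (𝓝 (μ (Iic x))) := by
  refine tendsto_signedMeasure_of_indicator μ measurableSet_Iic (fun _ => measurableSet_Iic) ?_
  intro z
  rcases le_or_gt z x with h | h
  · filter_upwards [self_mem_nhdsWithin] with y hy
    exact ⟨fun _ => h, fun _ => h.trans hy⟩
  · filter_upwards [mem_nhdsWithin_of_mem_nhds (gt_mem_nhds h)] with y hy
    exact ⟨fun h' => absurd hy (not_lt.2 h'), fun h' => absurd h (not_lt.2 h')⟩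

theorem tendsto_Iic_left (μ : SignedMeasure ℝ) (x : ℝ) :
    Tendsto (fun y => μ (Iic y)) (𝓝[<] x) (𝓝 (μ (Iio x))) := by
  refine tendsto_signedMeasure_of_indicator μ measurableSet_Iio (fun _ => measurableSet_Iic) ?_
  intro z
  rcases lt_or_ge z x with h | h
  · filter_upwards [mem_nhdsWithin_of_mem_nhds (lt_mem_nhds h)] with y hy
    exact ⟨fun _ => h, fun _ => hy.le⟩
  · filter_upwards [self_mem_nhdsWithin] with y hy
    exact ⟨fun h' => absurd (mem_Iio.1 hy) (not_lt.2 (h.trans h')), fun h' => absurd h' (not_lt.2 h)⟩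

theorem signedMeasure_Iic_eq (μ : SignedMeasure ℝ) (x : ℝ) : μ (Iic x) = μ (Iio x) + μ {x} := by
  rw [← Iio_union_right, VectorMeasure.of_union (by simp) measurableSet_Iio
    (measurableSet_singleton x)]

theorem signedMeasure_Iic_sub (μ : SignedMeasure ℝ) {x y : ℝ} (h : x ≤ y) :
    μ (Iic y) - μ (Iic x) = μ (Ioc x y) := by
  rw [← Iic_union_Ioc_eq_Iic h, VectorMeasure.of_union (by simp) measurableSet_Iic measurableSet_Ioc]
  ring

/-- Any representation as a difference of finite measures computes the integral: `μ⁺ + N = P + μ⁻`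
as positive measures. This avoids identifying the Jordan decomposition of sums and of point masses.
-/
theorem signedIntegral_eq {μ : SignedMeasure ℝ} {P N : Measure ℝ} [IsFiniteMeasure P]
    [IsFiniteMeasure N] (h : μ = P.toSignedMeasure - N.toSignedMeasure) {φ : ℝ → ℝ}
    (hφ : Continuous φ) (hc : HasCompactSupport φ) :
    signedIntegral μ φ = (∫ x, φ x ∂P) - ∫ x, φ x ∂N := by
  have hi : ∀ (ν : Measure ℝ) [IsFiniteMeasure ν], Integrable φ ν := fun ν _ =>
    hφ.integrable_of_hasCompactSupport hc
  have hj : P.toSignedMeasure - N.toSignedMeasure = μ.toJordanDecomposition.posPart.toSignedMeasure -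
      μ.toJordanDecomposition.negPart.toSignedMeasure :=
    h.symm.trans (SignedMeasure.toSignedMeasure_toJordanDecomposition μ).symm
  have h1 : μ.toJordanDecomposition.posPart + N = P + μ.toJordanDecomposition.negPart := by
    rw [← Measure.toSignedMeasure_eq_toSignedMeasure_iff, Measure.toSignedMeasure_add,
      Measure.toSignedMeasure_add]
    exact (sub_eq_sub_iff_add_eq_add.1 hj).symm
  have h2 := congrArg (fun ν => ∫ x, φ x ∂ν) h1
  simp only [integral_add_measure (hi _) (hi _)] at h2
  unfold signedIntegral
  linarith

/-- Fubini on the half-plane `y ≤ x`: the inner integral of `φ'` over `[y, ∞)` is `-φ y`. -/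
theorem integral_Iic_mul_deriv (P : Measure ℝ) [IsFiniteMeasure P] {φ : ℝ → ℝ}
    (hφ : ContDiff ℝ ∞ φ) (hc : HasCompactSupport φ) :
    ∫ x, P.real (Iic x) * deriv φ x = -∫ x, φ x ∂P := by
  have hφ1 : ContDiff ℝ 1 φ := hφ.of_le (by exact_mod_cast le_top)
  have hd : Integrable (deriv φ) :=
    (hφ1.continuous_deriv le_rfl).integrable_of_hasCompactSupport hc.deriv
  have e1 : ∀ x, P.real (Iic x) * deriv φ x =
      ∫ y, {p : ℝ × ℝ | p.2 ≤ p.1}.indicator (fun p => deriv φ p.1) (x, y) ∂P := by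
    intro x
    have : (fun y => {p : ℝ × ℝ | p.2 ≤ p.1}.indicator (fun p => deriv φ p.1) (x, y)) =
        (Iic x).indicator fun _ => deriv φ x := by
      ext y
      simp [indicator]
    rw [this, integral_indicator measurableSet_Iic, setIntegral_const, smul_eq_mul]
  have e2 : ∀ y, ∫ x, {p : ℝ × ℝ | p.2 ≤ p.1}.indicator (fun p => deriv φ p.1) (x, y) = -φ y := by
    intro y
    have : (fun x => {p : ℝ × ℝ | p.2 ≤ p.1}.indicator (fun p => deriv φ p.1) (x, y)) =
        (Ici y).indicator (deriv φ) := by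
      ext x
      simp [indicator]
    rw [this, integral_indicator measurableSet_Ici, integral_Ici_eq_integral_Ioi,
      hc.integral_Ioi_deriv_eq hφ1]
  simp_rw [e1]
  rw [integral_integral_swap
    (f := fun x y => {p : ℝ × ℝ | p.2 ≤ p.1}.indicator (fun p => deriv φ p.1) (x, y))]
  · simp_rw [e2]
    rw [integral_neg]
  · exact (hd.comp_fst P).indicator (measurableSet_le measurable_snd measurable_fst)

theorem deriv_eq_zero_of_tsupport_subset {φ : ℝ → ℝ} {S : Set ℝ} (h : tsupport φ ⊆ S) {x : ℝ}
    (hx : x ∉ S) : deriv φ x = 0 := by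
  by_contra hn
  exact hx (h (support_deriv_subset hn))

/-- `x ↦ μ (-∞, x]` has distributional derivative `μ`. -/
theorem setIntegral_Iic_mul_deriv (μ : SignedMeasure ℝ) {a b : ℝ} {φ : ℝ → ℝ}
    (hφ : ContDiff ℝ ∞ φ) (hc : HasCompactSupport φ) (hs : tsupport φ ⊆ Ioo a b) :
    ∫ x in Ioo a b, μ (Iic x) * deriv φ x = -signedIntegral μ φ := by
  rw [setIntegral_eq_integral_of_forall_compl_eq_zero fun x hx => by
    rw [deriv_eq_zero_of_tsupport_subset hs hx, mul_zero]]
  have hφ1 : ContDiff ℝ 1 φ := hφ.of_le (by exact_mod_cast le_top)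
  have hi : ∀ (P : Measure ℝ) [IsFiniteMeasure P],
      Integrable fun x => P.real (Iic x) * deriv φ x := by
    intro P _
    refine ((hφ1.continuous_deriv le_rfl).integrable_of_hasCompactSupport hc.deriv).bdd_mul
      (c := P.real univ) ?_ (ae_of_all _ fun x => ?_)
    · have : Monotone fun x => P.real (Iic x) := fun x y hxy =>
        measureReal_mono (Iic_subset_Iic.2 hxy)
      exact this.measurable.aestronglyMeasurable
    · rw [Real.norm_eq_abs, abs_of_nonneg measureReal_nonneg]
      exact measureReal_mono (subset_univ _)
  simp_rw [μ.apply_eq_posPart_real_sub_negPart_real measurableSet_Iic, sub_mul]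
  rw [integral_sub (hi _) (hi _), integral_Iic_mul_deriv _ hφ hc, integral_Iic_mul_deriv _ hφ hc]
  unfold signedIntegral
  ring

/-! ### The lemma of du Bois-Reymond -/

theorem exists_primitive {a b : ℝ} {φ : ℝ → ℝ} (hφ : ContDiff ℝ ∞ φ) (hc : HasCompactSupport φ)
    (hs : tsupport φ ⊆ Ioo a b) (h0 : ∫ x, φ x = 0) :
    ∃ Φ : ℝ → ℝ, ContDiff ℝ ∞ Φ ∧ HasCompactSupport Φ ∧ tsupport Φ ⊆ Ioo a b ∧ deriv Φ = φ := by
  have hd : ∀ x, HasDerivAt (fun x => ∫ t in a..x, φ t) (φ x) x := fun x =>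
    hφ.continuous.integral_hasStrictDerivAt a x |>.hasDerivAt
  have hderiv : deriv (fun x => ∫ t in a..x, φ t) = φ := funext fun x => (hd x).deriv
  have hz : ∀ x, x ∉ tsupport φ → φ x = 0 := fun x hx => image_eq_zero_of_notMem_tsupport hx
  obtain ⟨α, β, hα, hβ, hsub⟩ : ∃ α β, a < α ∧ β < b ∧ tsupport φ ⊆ Icc α β := by
    rcases (tsupport φ).eq_empty_or_nonempty with h | h
    -- For `φ = 0` any margins do; `α ≤ β` is never needed.
    · exact ⟨a + 1, b - 1, by linarith, by linarith, by simp [h]⟩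
    · have hK : IsCompact (tsupport φ) := hc
      obtain ⟨α, hα⟩ := hK.exists_isLeast h
      obtain ⟨β, hβ⟩ := hK.exists_isGreatest h
      exact ⟨α, β, (hs hα.1).1, (hs hβ.1).2, fun x hx => ⟨hα.2 hx, hβ.2 hx⟩⟩
  have hint : Integrable φ := hφ.continuous.integrable_of_hasCompactSupport hc
  have hleft : ∀ x, x < α → ∫ t in a..x, φ t = 0 := by
    intro x hx
    refine intervalIntegral.integral_zero_ae (ae_of_all _ fun t ht => hz t fun h => ?_)
    have h1 := (hsub h).1
    rcases le_total a x with h2 | h2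
    · rw [uIoc_of_le h2] at ht; linarith [ht.2]
    · rw [uIoc_of_ge h2] at ht; linarith [ht.2]
  have hright : ∀ x, β < x → ∫ t in a..x, φ t = 0 := by
    intro x hx
    have h1 : ∫ t in Iic x, φ t = 0 := by
      rw [setIntegral_eq_integral_of_forall_compl_eq_zero, h0]
      intro t ht
      exact hz t fun h => ht ((hsub h).2.trans hx.le)
    have h2 : ∫ t in Iic a, φ t = 0 :=
      setIntegral_eq_zero_of_forall_eq_zero fun t ht => hz t fun h =>
        absurd (hs h).1 (not_lt.2 ht)
    rw [← intervalIntegral.integral_Iic_sub_Iic hint.integrableOn hint.integrableOn, h1, h2, sub_zero]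
  have hsupp : tsupport (fun x => ∫ t in a..x, φ t) ⊆ Icc α β := by
    refine closure_minimal (fun x hx => ?_) isClosed_Icc
    refine ⟨?_, ?_⟩ <;> by_contra! h
    · exact hx (hleft x h)
    · exact hx (hright x h)
  refine ⟨fun x => ∫ t in a..x, φ t, ?_, ?_, ?_, hderiv⟩
  · rw [contDiff_infty_iff_deriv]
    exact ⟨fun x => (hd x).differentiableAt, by rw [hderiv]; exact hφ⟩
  · exact isCompact_Icc.of_isClosed_subset (isClosed_tsupport _) hsupp
  · exact hsupp.trans (Icc_subset_Ioo hα hβ)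

theorem exists_testFunction {a b : ℝ} (hab : a < b) : ∃ ψ : ℝ → ℝ, ContDiff ℝ ∞ ψ ∧
    HasCompactSupport ψ ∧ tsupport ψ ⊆ Ioo a b ∧ ∫ x, ψ x = 1 := by
  let f : ContDiffBump ((a + b) / 2) :=
    { rIn := (b - a) / 8
      rOut := (b - a) / 4
      rIn_pos := by linarith
      rIn_lt_rOut := by linarith }
  refine ⟨f.normed volume, f.contDiff_normed, f.hasCompactSupport_normed, ?_, f.integral_normed⟩
  rw [f.tsupport_normed_eq, Real.closedBall_eq_Icc]
  have e : f.rOut = (b - a) / 4 := rfl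
  rw [e]
  exact Icc_subset_Ioo (by linarith) (by linarith)

/-- **Du Bois-Reymond lemma**: a function with zero distributional derivative is constant. -/
theorem ae_eq_const_of_forall_integral_mul_deriv_eq_zero {a b : ℝ} (hab : a < b) {f : ℝ → ℝ}
    (hf : IntegrableOn f (Ioo a b))
    (h : ∀ φ : ℝ → ℝ, ContDiff ℝ ∞ φ → HasCompactSupport φ → tsupport φ ⊆ Ioo a b →
      ∫ x in Ioo a b, f x * deriv φ x = 0) :
    ∃ c, ∀ᵐ x, x ∈ Ioo a b → f x = c := by
  obtain ⟨ψ, hψ, hψc, hψs, hψ1⟩ := exists_testFunction hab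
  set c := ∫ x in Ioo a b, f x * ψ x with hcdef
  have hmul : ∀ φ : ℝ → ℝ, Continuous φ → HasCompactSupport φ →
      IntegrableOn (fun x => f x * φ x) (Ioo a b) := by
    intro φ hφ hc
    obtain ⟨B, hB⟩ := hc.exists_bound_of_continuous hφ
    exact hf.mul_bdd (c := B) hφ.aestronglyMeasurable (ae_of_all _ hB)
  refine ⟨c, ?_⟩
  have key := isOpen_Ioo.ae_eq_zero_of_integral_contDiff_smul_eq_zero (μ := volume)
    (U := Ioo a b) (f := fun x => f x - c)
    (hf.sub (integrableOn_const (by simp))).locallyIntegrableOn ?_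
  · filter_upwards [key] with x hx hxs
    exact sub_eq_zero.1 (hx hxs)
  intro φ hφ hc hs
  set m := ∫ x, φ x with hm
  -- Subtracting `m ψ` removes the mean of `φ`, so the difference is the derivative of a test
  -- function and `f` integrates to zero against it.
  obtain ⟨Φ, h1, h2, h3, h4⟩ := exists_primitive (φ := fun x => φ x - m * ψ x)
    (hφ.sub (contDiff_const.mul hψ)) (hc.sub (hψc.mul_left)) (a := a) (b := b)
    ((tsupport_sub _ _).trans (union_subset hs ((tsupport_mul_subset_right).trans hψs))) (by
      rw [integral_sub (hφ.continuous.integrable_of_hasCompactSupport hc)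
        ((hψ.continuous.integrable_of_hasCompactSupport hψc).const_mul m), integral_const_mul, hψ1,
        mul_one, sub_self])
  have h5 := h Φ h1 h2 h3
  rw [h4] at h5
  have h6 : ∫ x in Ioo a b, f x * (φ x - m * ψ x) = (∫ x in Ioo a b, f x * φ x) - m * c := by
    rw [hcdef, ← integral_const_mul, ← integral_sub (hmul φ hφ.continuous hc)
      ((hmul ψ hψ.continuous hψc).const_mul m)]
    congr 1 with x
    ring
  have h7 : ∫ x, φ x = ∫ x in Ioo a b, φ x :=
    (setIntegral_eq_integral_of_forall_compl_eq_zero fun x hx =>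
      image_eq_zero_of_notMem_tsupport fun h => hx (hs h)).symm
  rw [← setIntegral_eq_integral_of_forall_compl_eq_zero (s := Ioo a b) fun x hx => by
    rw [image_eq_zero_of_notMem_tsupport fun h => hx (hs h), zero_smul]]
  have h8 : ∫ x in Ioo a b, φ x • (f x - c) = (∫ x in Ioo a b, f x * φ x) - m * c := by
    rw [hm, h7, ← integral_mul_const, ← integral_sub (hmul φ hφ.continuous hc)
      ((hφ.continuous.integrable_of_hasCompactSupport hc).mul_const c).integrableOn]
    congr 1 with x
    rw [smul_eq_mul]
    ring
  rw [h8, ← h6, h5]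

/-- A function of bounded variation has the right-continuous representative `c + Du (-∞, x]`. -/
theorem HasDistribDeriv.exists_ae_eq {a b : ℝ} (hab : a < b) {u : ℝ → ℝ} {μ : SignedMeasure ℝ}
    (h : HasDistribDeriv a b u μ) (hu : IntegrableOn u (Ioo a b)) :
    ∃ c, ∀ᵐ x, x ∈ Ioo a b → u x = c + μ (Iic x) := by
  have hb : ∀ x, ‖μ (Iic x)‖ ≤ μ.totalVariation.real univ := fun x =>
    (μ.norm_le_totalVariation _).trans (measureReal_mono (subset_univ _))
  have hmeas : Measurable fun x => μ (Iic x) := by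
    simp_rw [μ.apply_eq_posPart_real_sub_negPart_real measurableSet_Iic]
    have : ∀ (P : Measure ℝ) [IsFiniteMeasure P], Monotone fun x => P.real (Iic x) :=
      fun P _ x y hxy => measureReal_mono (Iic_subset_Iic.2 hxy)
    exact (this _).measurable.sub (this _).measurable
  have hint : IntegrableOn (fun x => μ (Iic x)) (Ioo a b) :=
    IntegrableOn.of_bound (by simp) hmeas.aestronglyMeasurable _ (ae_of_all _ hb)
  obtain ⟨c, hc⟩ := ae_eq_const_of_forall_integral_mul_deriv_eq_zero hab (hu.sub hint)
    fun φ hφ hφc hs => by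
      have hcd : Continuous (deriv φ) :=
        ContDiff.continuous_deriv (n := 1) (hφ.of_le (by exact_mod_cast le_top)) le_rfl
      obtain ⟨B, hB⟩ := hφc.deriv.exists_bound_of_continuous hcd
      have hm : ∀ f, IntegrableOn f (Ioo a b) →
          IntegrableOn (fun x => f x * deriv φ x) (Ioo a b) := fun f hf =>
        hf.mul_bdd (c := B) hcd.aestronglyMeasurable (ae_of_all _ hB)
      simp_rw [Pi.sub_apply, sub_mul]
      rw [integral_sub (hm _ hu) (hm _ hint), h.integral_eq φ hφ hφc hs,
        setIntegral_Iic_mul_deriv μ hφ hφc hs, sub_self]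
  refine ⟨c, ?_⟩
  filter_upwards [hc] with x hx hxs
  have := hx hxs
  simp only [Pi.sub_apply] at this
  linarith

/-! ### Approximate traces -/

/-- Serves both traces: an ordinary one-sided limit of a representative is an approximate limit of
`u`. -/
theorem tendsto_setAverage_abs_sub {S : ℝ → Set ℝ} {l : Filter ℝ} {u f : ℝ → ℝ} {c : ℝ}
    (hS : ∀ V ∈ l, ∀ᶠ r in 𝓝[>] 0, S r ⊆ V)
    (hv : ∀ r, volume (S r) ≠ ⊤)
    (hf : Tendsto f l (𝓝 c)) {W : Set ℝ} (hW : W ∈ l) (hae : ∀ᵐ x, x ∈ W → u x = f x) :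
    Tendsto (fun r => ⨍ y in S r, |u y - c|) (𝓝[>] 0) (𝓝 0) := by
  rw [Metric.tendsto_nhds]
  intro ε hε
  have h1 : ∀ᶠ y in l, |f y - c| < ε / 2 := by
    have := Metric.tendsto_nhds.1 hf (ε / 2) (by linarith)
    simpa only [Real.dist_eq] using this
  filter_upwards [hS _ (inter_mem h1 hW)] with r hr
  rw [dist_zero_right, setAverage_eq, norm_smul]
  have h2 : ‖∫ y in S r, |u y - c|‖ ≤ ε / 2 * volume.real (S r) := by
    refine norm_setIntegral_le_of_norm_le_const_ae' (hv r).lt_top ?_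
    filter_upwards [hae] with y hy hyS
    obtain ⟨h3, h4⟩ := hr hyS
    rw [hy h4, Real.norm_eq_abs, abs_abs]
    exact le_of_lt h3
  rw [norm_inv, Real.norm_eq_abs, abs_of_nonneg measureReal_nonneg]
  rcases (measureReal_nonneg (μ := volume) (s := S r)).eq_or_lt with h0 | h0
  · rw [← h0, inv_zero, zero_mul]; exact hε
  · refine lt_of_le_of_lt (mul_le_mul_of_nonneg_left h2 (by positivity)) ?_
    have : (volume.real (S r))⁻¹ * (ε / 2 * volume.real (S r)) = ε / 2 := by field_simp
    linarith

theorem eq_of_tendsto_setAverage_abs_sub {S : ℝ → Set ℝ} {u : ℝ → ℝ} {c d : ℝ}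
    (hS : ∀ᶠ r in 𝓝[>] (0 : ℝ), IntegrableOn u (S r) ∧ volume (S r) ≠ ⊤ ∧ volume (S r) ≠ 0)
    (hc : Tendsto (fun r => ⨍ y in S r, |u y - c|) (𝓝[>] 0) (𝓝 0))
    (hd : Tendsto (fun r => ⨍ y in S r, |u y - d|) (𝓝[>] 0) (𝓝 0)) : c = d := by
  have key : ∀ᶠ r in 𝓝[>] (0 : ℝ), |c - d| ≤ (⨍ y in S r, |u y - c|) + ⨍ y in S r, |u y - d| := by
    filter_upwards [hS] with r hr
    obtain ⟨h1, h2, h3⟩ := hr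
    have hpos : 0 < volume.real (S r) := ENNReal.toReal_pos h3 h2
    have hi : ∀ e, IntegrableOn (fun y => |u y - e|) (S r) := fun e =>
      (h1.sub (integrableOn_const h2)).abs
    have h4 : ∫ _ in S r, |c - d| ≤ ∫ y in S r, (|u y - c| + |u y - d|) := by
      refine integral_mono (integrableOn_const h2) ((hi c).add (hi d)) fun y => ?_
      have := abs_sub_le c (u y) d
      rwa [abs_sub_comm c (u y)] at this
    rw [setIntegral_const, integral_add (hi c) (hi d), smul_eq_mul] at h4
    rw [setAverage_eq, setAverage_eq, smul_eq_mul, smul_eq_mul, ← mul_add, ← div_eq_inv_mul,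
      le_div_iff₀ hpos, mul_comm]
    exact h4
  have h := ge_of_tendsto (hc.add hd) key
  rw [add_zero] at h
  exact sub_eq_zero.1 (abs_nonpos_iff.1 h)

section

variable {a b c x : ℝ} {u : ℝ → ℝ} {μ : SignedMeasure ℝ}

theorem hasLeftTrace_of_rep (hx : x ∈ Ioo a b)
    (hrep : ∀ᵐ y, y ∈ Ioo a b → u y = c + μ (Iic y)) : HasLeftTrace u x (c + μ (Iio x)) := by
  refine tendsto_setAverage_abs_sub (l := 𝓝[<] x) (f := fun y => c + μ (Iic y)) (fun V hV => ?_)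
    (fun r => by simp) ((tendsto_Iic_left μ x).const_add c)
    (Ioo_mem_nhdsLT hx.1) (by
      filter_upwards [hrep] with y hy hys
      exact hy ⟨hys.1, hys.2.trans hx.2⟩)
  obtain ⟨l, hl, hsub⟩ := mem_nhdsLT_iff_exists_Ioo_subset.1 hV
  have hl' : 0 < x - l := sub_pos.2 hl
  filter_upwards [Ioo_mem_nhdsGT hl'] with r hr
  exact (Ioo_subset_Ioo_left (by linarith [hr.2])).trans hsub

theorem hasRightTrace_of_rep (hx : x ∈ Ioo a b)
    (hrep : ∀ᵐ y, y ∈ Ioo a b → u y = c + μ (Iic y)) : HasRightTrace u x (c + μ (Iic x)) := by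
  refine tendsto_setAverage_abs_sub (l := 𝓝[>] x) (f := fun y => c + μ (Iic y)) (fun V hV => ?_)
    (fun r => by simp)
    (((tendsto_Iic_right μ x).mono_left (nhdsWithin_mono x Ioi_subset_Ici_self)).const_add c)
    (Ioo_mem_nhdsGT hx.2) (by
      filter_upwards [hrep] with y hy hys
      exact hy ⟨hx.1.trans hys.1, hys.2⟩)
  obtain ⟨l, hl, hsub⟩ := mem_nhdsGT_iff_exists_Ioo_subset.1 hV
  have hl' : 0 < l - x := sub_pos.2 hl
  filter_upwards [Ioo_mem_nhdsGT hl'] with r hr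
  exact (Ioo_subset_Ioo_right (by linarith [hr.2])).trans hsub

theorem HasLeftTrace.unique {d : ℝ} (hx : x ∈ Ioo a b) (hu : IntegrableOn u (Ioo a b))
    (hc : HasLeftTrace u x c) (hd : HasLeftTrace u x d) : c = d := by
  refine eq_of_tendsto_setAverage_abs_sub ?_ hc hd
  have hl' : 0 < x - a := sub_pos.2 hx.1
  filter_upwards [Ioo_mem_nhdsGT hl'] with r hr
  refine ⟨hu.mono_set (Ioo_subset_Ioo (by linarith [hr.2]) hx.2.le), by simp, ?_⟩
  simpa using hr.1

theorem HasRightTrace.unique {d : ℝ} (hx : x ∈ Ioo a b) (hu : IntegrableOn u (Ioo a b))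
    (hc : HasRightTrace u x c) (hd : HasRightTrace u x d) : c = d := by
  refine eq_of_tendsto_setAverage_abs_sub ?_ hc hd
  have hl' : 0 < b - x := sub_pos.2 hx.2
  filter_upwards [Ioo_mem_nhdsGT hl'] with r hr
  refine ⟨hu.mono_set (Ioo_subset_Ioo hx.1.le (by linarith [hr.2])), by simp, ?_⟩
  simpa using hr.1

theorem leftTrace_eq (hx : x ∈ Ioo a b) (hu : IntegrableOn u (Ioo a b))
    (hc : HasLeftTrace u x c) : leftTrace u x = c := by
  have h : ∃ c, HasLeftTrace u x c := ⟨c, hc⟩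
  rw [leftTrace, dif_pos h]
  exact h.choose_spec.unique hx hu hc

theorem rightTrace_eq (hx : x ∈ Ioo a b) (hu : IntegrableOn u (Ioo a b))
    (hc : HasRightTrace u x c) : rightTrace u x = c := by
  have h : ∃ c, HasRightTrace u x c := ⟨c, hc⟩
  rw [rightTrace, dif_pos h]
  exact h.choose_spec.unique hx hu hc

/-- The traces of `u` at `x` are `c + μ (Iio x)` and `c + μ (Iic x)`, which differ by the atom `μ
{x}`. -/
theorem jumpSet_eq (hu : IntegrableOn u (Ioo a b))
    (hrep : ∀ᵐ y, y ∈ Ioo a b → u y = c + μ (Iic y)) :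
    jumpSet a b u = {x ∈ Ioo a b | μ {x} ≠ 0} := by
  ext x
  constructor
  · rintro ⟨hx, p, q, hpq, hp, hq⟩
    refine ⟨hx, fun h0 => hpq ?_⟩
    rw [hp.unique hx hu (hasLeftTrace_of_rep hx hrep),
      hq.unique hx hu (hasRightTrace_of_rep hx hrep), signedMeasure_Iic_eq, h0, add_zero]
  · rintro ⟨hx, h0⟩
    refine ⟨hx, _, _, ?_, hasLeftTrace_of_rep hx hrep, hasRightTrace_of_rep hx hrep⟩
    rw [signedMeasure_Iic_eq]
    intro h
    exact h0 (by linarith)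

theorem continuousAt_rep_iff : ContinuousAt (fun y => c + μ (Iic y)) x ↔ μ {x} = 0 := by
  rw [continuousAt_iff_continuous_left'_right']
  have hr : ContinuousWithinAt (fun y => c + μ (Iic y)) (Ioi x) x :=
    ((tendsto_Iic_right μ x).mono_left (nhdsWithin_mono x Ioi_subset_Ici_self)).const_add c
  have hl := (tendsto_Iic_left μ x).const_add c
  constructor
  · rintro ⟨h, -⟩
    have : c + μ (Iic x) = c + μ (Iio x) := tendsto_nhds_unique h hl
    rw [signedMeasure_Iic_eq] at this
    linarith
  · intro h
    refine ⟨?_, hr⟩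
    rw [ContinuousWithinAt, signedMeasure_Iic_eq, h, add_zero]
    exact hl

theorem countable_atoms (μ : SignedMeasure ℝ) : {x | μ {x} ≠ 0}.Countable := by
  have h := Measure.countable_meas_pos_of_disjoint_iUnion (μ := μ.totalVariation)
    (As := fun x : ℝ => {x}) (fun x => measurableSet_singleton x)
    (fun x y hxy => disjoint_singleton.2 hxy)
  refine h.mono ?_
  intro x hx
  rw [mem_ofPred_eq, pos_iff_ne_zero]
  exact fun h0 => hx (μ.null_of_totalVariation_zero h0)

theorem tame_rep (a b c : ℝ) (μ : SignedMeasure ℝ) : Tame a b fun y => c + μ (Iic y) := by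
  refine ⟨⟨|c| + μ.totalVariation.real univ, fun x _ => (abs_add_le _ _).trans ?_⟩,
    (countable_atoms μ).mono ?_⟩
  · exact add_le_add le_rfl ((μ.norm_le_totalVariation _).trans (measureReal_mono (subset_univ _)))
  · rintro x ⟨-, hx⟩
    exact fun h => hx (continuousAt_rep_iff.2 h)

/-! ### Uniqueness of the distributional derivative -/

/-- Needed because `distribDeriv` is a chosen witness. The two distribution functions differ by a
constant on `(a, b)`, almost everywhere and then everywhere by right continuity. -/
theorem HasDistribDeriv.unique (hab : a < b) {μ' : SignedMeasure ℝ} (h : HasDistribDeriv a b u μ)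
    (h' : HasDistribDeriv a b u μ') (hu : IntegrableOn u (Ioo a b)) : μ = μ' := by
  obtain ⟨c, hc⟩ := h.exists_ae_eq hab hu
  obtain ⟨c', hc'⟩ := h'.exists_ae_eq hab hu
  have hnull : ∀ S : Set ℝ, S ⊆ (Ioo a b)ᶜ → μ S = 0 ∧ μ' S = 0 := fun S hS =>
    ⟨μ.null_of_totalVariation_zero (measure_mono_null hS h.carried),
      μ'.null_of_totalVariation_zero (measure_mono_null hS h'.carried)⟩
  have hle : ∀ (d e : ℝ) (ν ν' : SignedMeasure ℝ),
      (∀ᵐ x, x ∈ Ioo a b → d + ν (Iic x) = e + ν' (Iic x)) →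
      ∀ x ∈ Ioo a b, d + ν (Iic x) - (e + ν' (Iic x)) ≤ 0 := by
    intro d e ν ν' hae
    refine le_of_ae_le_of_rightCont (fun x _ => ?_) ?_
    · exact ((tendsto_Iic_right ν x).const_add d).sub ((tendsto_Iic_right ν' x).const_add e)
    · filter_upwards [hae] with x hx hxs
      rw [hx hxs, sub_self]
  have heq : ∀ x ∈ Ioo a b, μ (Iic x) - μ' (Iic x) = c' - c := by
    intro x hx
    have h1 := hle c c' μ μ' (by
      filter_upwards [hc, hc'] with x h1 h2 h3
      rw [← h1 h3, ← h2 h3]) x hx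
    have h2 := hle c' c μ' μ (by
      filter_upwards [hc, hc'] with x h1 h2 h3
      rw [← h1 h3, ← h2 h3]) x hx
    linarith
  -- Letting `x ↓ a` identifies the constant, since neither measure charges `(-∞, a]`.
  have hcc : c' - c = 0 := by
    have h1 : Tendsto (fun x => μ (Iic x) - μ' (Iic x)) (𝓝[>] a) (𝓝 0) := by
      have := (((tendsto_Iic_right μ a).sub (tendsto_Iic_right μ' a))).mono_left
        (nhdsWithin_mono a Ioi_subset_Ici_self)
      have h0 := hnull (Iic a) fun x hx hx' => (not_lt.2 hx) hx'.1
      rwa [h0.1, h0.2, sub_zero] at this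
    have h2 : Tendsto (fun x => μ (Iic x) - μ' (Iic x)) (𝓝[>] a) (𝓝 (c' - c)) :=
      tendsto_const_nhds.congr' (by
        filter_upwards [Ioo_mem_nhdsGT hab] with x hx
        exact (heq x hx).symm)
    exact tendsto_nhds_unique h2 h1
  rw [hcc] at heq
  have hb : μ (Iio b) - μ' (Iio b) = 0 := by
    refine tendsto_nhds_unique ((tendsto_Iic_left μ b).sub (tendsto_Iic_left μ' b))
      (tendsto_const_nhds.congr' ?_)
    filter_upwards [Ioo_mem_nhdsLT hab] with x hx
    exact (heq x hx).symm
  have hIic : ∀ x, μ (Iic x) = μ' (Iic x) := by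
    intro x
    rcases le_or_gt x a with hxa | hxa
    · have := hnull (Iic x) fun y hy hy' => (not_lt.2 (le_trans hy hxa)) hy'.1
      rw [this.1, this.2]
    rcases lt_or_ge x b with hxb | hxb
    · exact sub_eq_zero.1 (heq x ⟨hxa, hxb⟩)
    · have h0 := hnull (Icc b x) fun y hy hy' => (not_lt.2 hy.1) hy'.2
      have e : ∀ ν : SignedMeasure ℝ, ν (Iic x) = ν (Iio b) + ν (Icc b x) := fun ν => by
        rw [← Iio_union_Icc_eq_Iic hxb, VectorMeasure.of_union (by
          rw [Set.disjoint_left]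
          exact fun y hy hy' => (not_lt.2 hy'.1) hy) measurableSet_Iio measurableSet_Icc]
      rw [e, e, h0.1, h0.2, sub_eq_zero.1 hb]
  -- Moving negative parts across turns the identity on half-lines into one between finite positive
  -- measures, which half-lines determine.
  have hm : μ.toJordanDecomposition.posPart + μ'.toJordanDecomposition.negPart =
      μ'.toJordanDecomposition.posPart + μ.toJordanDecomposition.negPart := by
    refine Measure.ext_of_Iic _ _ fun x => ?_
    rw [← measureReal_eq_measureReal_iff, measureReal_add_apply, measureReal_add_apply]
    have := hIic x
    rw [μ.apply_eq_posPart_real_sub_negPart_real measurableSet_Iic,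
      μ'.apply_eq_posPart_real_sub_negPart_real measurableSet_Iic] at this
    linarith
  ext S hS
  have h1 : (μ.toJordanDecomposition.posPart + μ'.toJordanDecomposition.negPart).real S =
      (μ'.toJordanDecomposition.posPart + μ.toJordanDecomposition.negPart).real S := by rw [hm]
  rw [measureReal_add_apply, measureReal_add_apply] at h1
  rw [μ.apply_eq_posPart_real_sub_negPart_real hS, μ'.apply_eq_posPart_real_sub_negPart_real hS]
  linarith

theorem HasDistribDeriv.distribDeriv_eq (hab : a < b) (h : HasDistribDeriv a b u μ)
    (hu : IntegrableOn u (Ioo a b)) : distribDeriv a b u = μ := by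
  have hex : ∃ μ : SignedMeasure ℝ, HasDistribDeriv a b u μ := ⟨μ, h⟩
  rw [distribDeriv, dif_pos hex]
  exact hex.choose_spec.unique hab h hu

/-! ### The energy in terms of the derivative -/

/-- The jump part of the energy, as a measure. -/
def jumpMeasure (K : ℝ≥0 → ℝ≥0) (a b : ℝ) (μ : SignedMeasure ℝ) : Measure ℝ :=
  Measure.sum fun x : {x ∈ Ioo a b | μ {x} ≠ 0} => (K ‖μ {(x : ℝ)}‖₊ : ℝ≥0∞) • Measure.dirac (x : ℝ)

theorem HasDistribDeriv.TVK_eq (K : ℝ≥0 → ℝ≥0) (hab : a < b) (h : HasDistribDeriv a b u μ)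
    (hu : IntegrableOn u (Ioo a b)) :
    TVK K a b u = μ.totalVariation (Ioo a b \ {x ∈ Ioo a b | μ {x} ≠ 0}) +
      ∑' x : {x ∈ Ioo a b | μ {x} ≠ 0}, (K ‖μ {(x : ℝ)}‖₊ : ℝ≥0∞) := by
  obtain ⟨c, hrep⟩ := h.exists_ae_eq hab hu
  have key : ∀ x ∈ Ioo a b, nndist (rightTrace u x) (leftTrace u x) = ‖μ {x}‖₊ := by
    intro x hx
    rw [rightTrace_eq hx hu (hasRightTrace_of_rep hx hrep),
      leftTrace_eq hx hu (hasLeftTrace_of_rep hx hrep), signedMeasure_Iic_eq, nndist_eq_nnnorm]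
    congr 1
    ring
  rw [TVK, h.distribDeriv_eq hab hu, jumpSet_eq hu hrep]
  congr 1
  exact tsum_congr fun x => by rw [key x x.2.1]

/-- Finite subadditivity of `K` treats finitely many atoms one by one; the rest of `I` is bounded
through `K ρ ≤ ρ` by total variation, in which the omitted atoms weigh at most `ε`. -/
theorem le_totalVariation_add_jumpMeasure {K : ℝ≥0 → ℝ≥0} [IsCost K] {I : Set ℝ}
    (hI : MeasurableSet I) :
    (K ‖μ I‖₊ : ℝ≥0∞) ≤ μ.totalVariation (I \ {x ∈ Ioo a b | μ {x} ≠ 0}) + jumpMeasure K a b μ I := by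
  set A := {x ∈ Ioo a b | μ {x} ≠ 0} with hA
  have hAc : A.Countable := (countable_atoms μ).mono fun x hx => hx.2
  have hAI : (A ∩ I).Countable := hAc.mono inter_subset_left
  have hAm : MeasurableSet A := hAc.measurableSet
  set T := μ.totalVariation with hT
  have hTs : T (A ∩ I) = ∑' x : (A ∩ I : Set ℝ), T {(x : ℝ)} := by
    conv_lhs => rw [← biUnion_of_singleton (A ∩ I)]
    exact measure_biUnion hAI (fun x _ y _ hxy => disjoint_singleton.2 hxy)
      fun x _ => measurableSet_singleton x
  refine ENNReal.le_of_forall_pos_le_add fun ε hε _ => ?_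
  obtain ⟨F, hFsub, hF⟩ : ∃ F : Finset ℝ, (F : Set ℝ) ⊆ A ∩ I ∧ T (A ∩ I) ≤ T F + ε := by
    have hlt : T (A ∩ I) < (⨆ s : Finset (A ∩ I : Set ℝ), ∑ x ∈ s, T {(x : ℝ)}) + ε := by
      rw [← ENNReal.tsum_eq_iSup_sum, ← hTs]
      exact ENNReal.lt_add_right (measure_ne_top _ _) (by exact_mod_cast hε.ne')
    rw [ENNReal.iSup_add] at hlt
    obtain ⟨s, hs⟩ := lt_iSup_iff.1 hlt
    refine ⟨s.map (Function.Embedding.subtype _), ?_, ?_⟩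
    · intro x hx
      simp only [Finset.coe_map, Function.Embedding.subtype_apply, mem_image] at hx
      obtain ⟨y, -, rfl⟩ := hx
      exact y.2
    · rw [← sum_measure_singleton, Finset.sum_map]
      exact hs.le
  have hFm : MeasurableSet (F : Set ℝ) := F.measurableSet
  have hFI : (F : Set ℝ) ⊆ I := hFsub.trans inter_subset_right
  have hμF : μ F = ∑ x ∈ F, μ {x} := by
    classical
    have : ∀ G : Finset ℝ, μ G = ∑ x ∈ G, μ {x} := by
      intro G
      induction G using Finset.induction_on with
      | empty => simp
      | insert x G hx ih =>
        rw [Finset.sum_insert hx, Finset.coe_insert, insert_eq, VectorMeasure.of_union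
          (by simpa using hx) (measurableSet_singleton x) G.measurableSet, ih]
    exact this F
  have hsplit : μ I = μ (I \ F) + ∑ x ∈ F, μ {x} := by
    rw [← hμF, add_comm, ← VectorMeasure.of_union disjoint_sdiff_right hFm (hI.diff hFm),
      union_sdiff_cancel hFI]
  have hK1 : (K ‖μ I‖₊ : ℝ≥0∞) ≤ ‖μ (I \ F)‖ₑ + ∑ x ∈ F, (K ‖μ {x}‖₊ : ℝ≥0∞) := by
    have hsum : ∀ G : Finset ℝ, K (∑ x ∈ G, ‖μ {x}‖₊) ≤ ∑ x ∈ G, K ‖μ {x}‖₊ := fun G =>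
      Finset.le_sum_of_subadditive K IsCost.zero.le IsCost.subadd G _
    have h1 : ‖μ I‖₊ ≤ ‖μ (I \ F)‖₊ + ∑ x ∈ F, ‖μ {x}‖₊ := by
      rw [hsplit]
      exact (nnnorm_add_le _ _).trans (add_le_add le_rfl (nnnorm_sum_le _ _))
    have h2 : K ‖μ I‖₊ ≤ ‖μ (I \ F)‖₊ + ∑ x ∈ F, K ‖μ {x}‖₊ :=
      (IsCost.mono h1).trans ((IsCost.subadd _ _).trans (add_le_add (IsCost.le_self _) (hsum F)))
    exact (ENNReal.coe_le_coe.2 h2).trans_eq (by push_cast; rfl)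
  have hK2 : ∑ x ∈ F, (K ‖μ {x}‖₊ : ℝ≥0∞) ≤ jumpMeasure K a b μ I := by
    rw [jumpMeasure, Measure.sum_apply _ hI]
    have hmem : ∀ x : {x // x ∈ F}, (x : ℝ) ∈ A := fun x => (hFsub x.2).1
    rw [← Finset.sum_coe_sort]
    let e : {x // x ∈ F} ↪ A := ⟨fun x => ⟨x, hmem x⟩, fun x y hxy => Subtype.ext (by
      simpa using hxy)⟩
    have e1 : ∑ x : {x // x ∈ F}, (K ‖μ {(x : ℝ)}‖₊ : ℝ≥0∞) = ∑ x ∈ Finset.univ.map e,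
        ((K ‖μ {(x : ℝ)}‖₊ : ℝ≥0∞) • Measure.dirac (x : ℝ)) I := by
      rw [Finset.sum_map]
      refine Finset.sum_congr rfl fun x _ => ?_
      rw [Measure.smul_apply, Measure.dirac_apply' _ hI,
        indicator_of_mem (show ((e x : A) : ℝ) ∈ I from hFI x.2)]
      exact (mul_one _).symm
    rw [e1]
    exact ENNReal.sum_le_tsum _
  have hT1 : T (I \ F) ≤ T (I \ A) + ε := by
    have h1 : I \ F ⊆ (I \ A) ∪ ((A ∩ I) \ F) := by
      intro x hx
      by_cases hxA : x ∈ A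
      · exact Or.inr ⟨⟨hxA, hx.1⟩, hx.2⟩
      · exact Or.inl ⟨hx.1, hxA⟩
    refine (measure_mono h1).trans ((measure_union_le _ _).trans (add_le_add le_rfl ?_))
    rw [measure_sdiff hFsub hFm.nullMeasurableSet (measure_ne_top _ _)]
    exact tsub_le_iff_left.2 hF
  calc (K ‖μ I‖₊ : ℝ≥0∞) ≤ T (I \ F) + jumpMeasure K a b μ I :=
        hK1.trans (add_le_add (μ.enorm_le_totalVariation _) hK2)
    _ ≤ T (I \ A) + ε + jumpMeasure K a b μ I := by gcongr
    _ = T (I \ A) + jumpMeasure K a b μ I + ε := by ring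

/-- Each increment of the representative is `μ` of a half-open interval, and the intervals of a
subdivision are disjoint, so the bounds on single intervals add up to one measure of `(a, b)`. -/
theorem HasDistribDeriv.kVar_le_TVK {K : ℝ≥0 → ℝ≥0} [IsCost K] (hab : a < b)
    (h : HasDistribDeriv a b u μ) (hu : IntegrableOn u (Ioo a b)) (c : ℝ) :
    kVar K (fun x => c + μ (Iic x)) (Ioo a b) ≤ TVK K a b u := by
  set A := {x ∈ Ioo a b | μ {x} ≠ 0} with hA
  have hAm : MeasurableSet A := ((countable_atoms μ).mono fun x hx => hx.2).measurableSet
  rw [h.TVK_eq K hab hu]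
  set ν := μ.totalVariation.restrict Aᶜ + jumpMeasure K a b μ with hν
  refine kVar_le fun n p hp hs => ?_
  have hIoc : ∀ i, Ioc (p i) (p (i + 1)) ⊆ Ioo a b := fun i =>
    (Ioc_subset_Ioo_right (hs (i + 1)).2).trans (Ioo_subset_Ioo_left (hs i).1.le)
  calc ∑ i ∈ Finset.range n,
        (K (nndist (c + μ (Iic (p (i + 1)))) (c + μ (Iic (p i)))) : ℝ≥0∞)
      ≤ ∑ i ∈ Finset.range n, ν (Ioc (p i) (p (i + 1))) := by
        refine Finset.sum_le_sum fun i _ => ?_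
        rw [nndist_add_left, nndist_eq_nnnorm, signedMeasure_Iic_sub μ (hp i.le_succ), hν,
          Measure.add_apply, Measure.restrict_apply measurableSet_Ioc, ← sdiff_eq]
        exact le_totalVariation_add_jumpMeasure measurableSet_Ioc
    _ = ν (⋃ i ∈ Finset.range n, Ioc (p i) (p (i + 1))) :=
        (measure_biUnion_finset (fun i _ j _ hij => hp.pairwise_disjoint_on_Ioc_succ hij)
          fun i _ => measurableSet_Ioc).symm
    _ ≤ ν (Ioo a b) := measure_mono (iUnion₂_subset fun i _ => hIoc i)
    _ = _ := by
        rw [hν, Measure.add_apply, Measure.restrict_apply measurableSet_Ioo, ← sdiff_eq,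
          jumpMeasure, Measure.sum_apply _ measurableSet_Ioo]
        congr 1
        refine tsum_congr fun x => ?_
        rw [Measure.smul_apply, Measure.dirac_apply' _ measurableSet_Ioo,
          indicator_of_mem x.2.1]
        simp

end

/-! ### Step functions -/

/-- The Jordan parts agree on all measurable subsets of `S` but live on complementary sets, so both
vanish there. -/
theorem totalVariation_eq_zero_of_forall {μ : SignedMeasure ℝ} {S : Set ℝ} (hS : MeasurableSet S)
    (h : ∀ B ⊆ S, MeasurableSet B → μ B = 0) : μ.totalVariation S = 0 := by
  obtain ⟨A, hA, hp, hn⟩ := μ.toJordanDecomposition.mutuallySingular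
  have key : ∀ B ⊆ S, MeasurableSet B →
      μ.toJordanDecomposition.posPart B = μ.toJordanDecomposition.negPart B := by
    intro B hB hBm
    have h1 := h B hB hBm
    rw [μ.apply_eq_posPart_real_sub_negPart_real hBm, sub_eq_zero] at h1
    exact (measureReal_eq_measureReal_iff).1 h1
  have hpA := measure_mono_null (inter_subset_right (s := S)) hp
  have hnA := measure_mono_null (inter_subset_right (s := S)) hn
  have hpA' := key _ inter_subset_left (hS.inter hA.compl)
  have hnA' := key _ inter_subset_left (hS.inter hA)
  rw [hnA] at hpA'
  rw [hpA] at hnA'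
  rw [SignedMeasure.totalVariation, Measure.add_apply, ← inter_union_compl S A]
  rw [measure_union_null hpA hpA', measure_union_null hnA'.symm hnA, add_zero]

variable {a b : ℝ}

theorem HasDistribDeriv.add {u v : ℝ → ℝ} {μ ν : SignedMeasure ℝ} (hu : HasDistribDeriv a b u μ)
    (hv : HasDistribDeriv a b v ν) (hui : IntegrableOn u (Ioo a b))
    (hvi : IntegrableOn v (Ioo a b)) : HasDistribDeriv a b (fun x => u x + v x) (μ + ν) where
  carried := totalVariation_eq_zero_of_forall measurableSet_Ioo.compl fun B hB _ => by
    rw [add_apply,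
      μ.null_of_totalVariation_zero (measure_mono_null hB hu.carried),
      ν.null_of_totalVariation_zero (measure_mono_null hB hv.carried), add_zero]
  integral_eq φ hφ hc hs := by
    have hcd : Continuous (deriv φ) :=
      ContDiff.continuous_deriv (n := 1) (hφ.of_le (by exact_mod_cast le_top)) le_rfl
    obtain ⟨B, hB⟩ := hc.deriv.exists_bound_of_continuous hcd
    have hm : ∀ f, IntegrableOn f (Ioo a b) →
        IntegrableOn (fun x => f x * deriv φ x) (Ioo a b) := fun f hf =>
      hf.mul_bdd (c := B) hcd.aestronglyMeasurable (ae_of_all _ hB)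
    have hi : ∀ (ρ : Measure ℝ) [IsFiniteMeasure ρ], Integrable φ ρ := fun ρ _ =>
      hφ.continuous.integrable_of_hasCompactSupport hc
    -- The summed parts need not be mutually singular, but `signedIntegral_eq` accepts any such
    -- difference.
    have e : μ + ν =
        (μ.toJordanDecomposition.posPart + ν.toJordanDecomposition.posPart).toSignedMeasure -
        (μ.toJordanDecomposition.negPart + ν.toJordanDecomposition.negPart).toSignedMeasure := by
      ext S hS
      rw [add_apply, Measure.toSignedMeasure_sub_apply hS, measureReal_add_apply,
        measureReal_add_apply, μ.apply_eq_posPart_real_sub_negPart_real hS,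
        ν.apply_eq_posPart_real_sub_negPart_real hS]
      ring
    simp_rw [add_mul]
    rw [integral_add (hm _ hui) (hm _ hvi), hu.integral_eq φ hφ hc hs, hv.integral_eq φ hφ hc hs,
      signedIntegral_eq e hφ.continuous hc, integral_add_measure (hi _) (hi _),
      integral_add_measure (hi _) (hi _)]
    unfold signedIntegral
    ring

theorem hasDistribDeriv_const (c : ℝ) : HasDistribDeriv a b (fun _ => c) 0 where
  carried := by rw [SignedMeasure.totalVariation_zero]; rfl
  integral_eq φ hφ hc hs := by
    have e : (0 : SignedMeasure ℝ) =
        (0 : Measure ℝ).toSignedMeasure - (0 : Measure ℝ).toSignedMeasure := by simp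
    have h : ∫ x, deriv φ x = 0 := integral_eq_zero_of_hasDerivAt_of_integrable
      (fun x => (hφ.differentiable (by simp) x).hasDerivAt)
      ((ContDiff.continuous_deriv (n := 1) (hφ.of_le (by exact_mod_cast le_top))
        le_rfl).integrable_of_hasCompactSupport hc.deriv)
      (hφ.continuous.integrable_of_hasCompactSupport hc)
    rw [setIntegral_eq_integral_of_forall_compl_eq_zero fun x hx => by
      rw [deriv_eq_zero_of_tsupport_subset hs hx, mul_zero], integral_const_mul, h,
      signedIntegral_eq e hφ.continuous hc]
    simp

theorem hasDistribDeriv_ite {t : ℝ} (ht : t ∈ Ioo a b) (j : ℝ) :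
    HasDistribDeriv a b (fun x => if t ≤ x then j else 0) (VectorMeasure.dirac t j) where
  carried := totalVariation_eq_zero_of_forall measurableSet_Ioo.compl fun B hB _ =>
    VectorMeasure.dirac_apply_of_notMem fun h => hB h ht
  integral_eq φ hφ hc hs := by
    -- Split `j` into its positive and negative parts to write the point mass as a difference of
    -- positive measures.
    have e : (VectorMeasure.dirac t j : SignedMeasure ℝ) =
        (j.toNNReal • Measure.dirac t).toSignedMeasure -
        ((-j).toNNReal • Measure.dirac t).toSignedMeasure := by
      ext S hS
      rw [Measure.toSignedMeasure_sub_apply hS, measureReal_nnreal_smul_apply,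
        measureReal_nnreal_smul_apply, Real.coe_toNNReal', Real.coe_toNNReal', ← sub_mul,
        max_zero_sub_eq_self]
      by_cases h : t ∈ S
      · rw [VectorMeasure.dirac_apply_of_mem hS h]
        simp [measureReal_def, h]
      · rw [VectorMeasure.dirac_apply_of_notMem h]
        simp [measureReal_def, h, hS]
    rw [setIntegral_eq_integral_of_forall_compl_eq_zero fun x hx => by
      rw [deriv_eq_zero_of_tsupport_subset hs hx, mul_zero], signedIntegral_eq e hφ.continuous hc]
    have h1 : (fun x => (if t ≤ x then j else 0) * deriv φ x) =
        (Ici t).indicator fun x => j * deriv φ x := by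
      ext x
      by_cases h : t ≤ x <;> simp [h]
    rw [h1, integral_indicator measurableSet_Ici, integral_Ici_eq_integral_Ioi, integral_const_mul,
      hc.integral_Ioi_deriv_eq (hφ.of_le (by exact_mod_cast le_top)), integral_smul_nnreal_measure,
      integral_smul_nnreal_measure, integral_dirac, NNReal.smul_def, NNReal.smul_def,
      Real.coe_toNNReal', Real.coe_toNNReal', ← sub_smul, max_zero_sub_eq_self, smul_eq_mul]
    ring

/-- The right-continuous step function equal to `w (t i)` on `[t i, t (i + 1))`. -/
def stepFun (w : ℝ → ℝ) (t : ℕ → ℝ) (n : ℕ) (x : ℝ) : ℝ :=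
  w (t 0) + ∑ i ∈ Finset.range n, if t (i + 1) ≤ x then w (t (i + 1)) - w (t i) else 0

/-- The derivative of `stepFun`. -/
def stepDeriv (w : ℝ → ℝ) (t : ℕ → ℝ) (n : ℕ) : SignedMeasure ℝ :=
  ∑ i ∈ Finset.range n, VectorMeasure.dirac (t (i + 1)) (w (t (i + 1)) - w (t i))

theorem stepFun_succ (w : ℝ → ℝ) (t : ℕ → ℝ) (n : ℕ) (x : ℝ) : stepFun w t (n + 1) x =
    stepFun w t n x + if t (n + 1) ≤ x then w (t (n + 1)) - w (t n) else 0 := by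
  rw [stepFun, stepFun, Finset.sum_range_succ, add_assoc]

theorem measurable_stepFun (w : ℝ → ℝ) (t : ℕ → ℝ) (n : ℕ) : Measurable (stepFun w t n) := by
  refine measurable_const.add (Finset.measurable_sum _ fun i _ => ?_)
  exact Measurable.ite measurableSet_Ici measurable_const measurable_const

theorem integrableOn_ite (t j : ℝ) :
    IntegrableOn (fun x => if t ≤ x then j else 0) (Ioo a b) := by
  refine IntegrableOn.of_bound (by simp)
    (Measurable.ite measurableSet_Ici measurable_const measurable_const).aestronglyMeasurable
    ‖j‖ (ae_of_all _ fun x => ?_)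
  split_ifs <;> simp

theorem stepFun_integrableOn (w : ℝ → ℝ) (t : ℕ → ℝ) (n : ℕ) :
    IntegrableOn (stepFun w t n) (Ioo a b) := by
  refine (integrableOn_const (by simp)).add (integrable_finsetSum _ fun i _ => ?_)
  exact integrableOn_ite _ _

theorem hasDistribDeriv_stepFun (w : ℝ → ℝ) {t : ℕ → ℝ} {n : ℕ} (ht : ∀ i ≤ n, t i ∈ Ioo a b) :
    HasDistribDeriv a b (stepFun w t n) (stepDeriv w t n) := by
  induction n with
  | zero =>
    have : stepFun w t 0 = fun _ => w (t 0) := by ext x; simp [stepFun]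
    rw [this, stepDeriv, Finset.range_zero, Finset.sum_empty]
    exact hasDistribDeriv_const _
  | succ n ih =>
    have e : stepFun w t (n + 1) = fun x => stepFun w t n x +
        if t (n + 1) ≤ x then w (t (n + 1)) - w (t n) else 0 := funext (stepFun_succ w t n)
    rw [e, stepDeriv, Finset.sum_range_succ]
    exact (ih fun i hi => ht i (by omega)).add (hasDistribDeriv_ite (ht _ le_rfl) _)
      (stepFun_integrableOn w t n) (integrableOn_ite _ _)

theorem stepDeriv_apply (w : ℝ → ℝ) (t : ℕ → ℝ) (n : ℕ) {S : Set ℝ} (hS : MeasurableSet S) :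
    stepDeriv w t n S = ∑ i ∈ Finset.range n,
      S.indicator (fun _ => w (t (i + 1)) - w (t i)) (t (i + 1)) := by
  induction n with
  | zero => simp [stepDeriv]
  | succ n ih =>
    rw [stepDeriv] at ih ⊢
    rw [Finset.sum_range_succ, add_apply, ih, Finset.sum_range_succ]
    congr 1
    by_cases h : t (n + 1) ∈ S
    · rw [VectorMeasure.dirac_apply_of_mem hS h, indicator_of_mem h]
    · rw [VectorMeasure.dirac_apply_of_notMem h, indicator_of_notMem h]

theorem stepDeriv_singleton (w : ℝ → ℝ) {t : ℕ → ℝ} (ht : StrictMono t) {n i : ℕ} (hi : i < n) :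
    stepDeriv w t n {t (i + 1)} = w (t (i + 1)) - w (t i) := by
  rw [stepDeriv_apply w t n (measurableSet_singleton _),
    Finset.sum_eq_single_of_mem i (Finset.mem_range.2 hi)]
  · simp
  · intro k _ hk
    refine indicator_of_notMem (fun h => hk ?_) _
    have := ht.injective (mem_singleton_iff.1 h)
    omega

/-- The derivative is purely atomic, so only jumps contribute, and these are increments of `w` over
one subdivision. Nodes where `w` does not change carry no atom, hence an injection of atoms into
indices rather than a bijection. -/
theorem TVK_stepFun_le (K : ℝ≥0 → ℝ≥0) [IsCost K] (hab : a < b) (w : ℝ → ℝ) {t : ℕ → ℝ}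
    (hmono : StrictMono t) {n : ℕ} (ht : ∀ i ≤ n, t i ∈ Ioo a b) :
    TVK K a b (stepFun w t n) ≤ kVar K w (Ioo a b) := by
  rw [(hasDistribDeriv_stepFun w ht).TVK_eq K hab (stepFun_integrableOn w t n)]
  set A := {x ∈ Ioo a b | stepDeriv w t n {x} ≠ 0} with hA
  have hAm : MeasurableSet A := ((countable_atoms _).mono fun x hx => hx.2).measurableSet
  rw [totalVariation_eq_zero_of_forall (measurableSet_Ioo.diff hAm), zero_add]
  · have hex : ∀ x : A, ∃ i < n, t (i + 1) = x := by
      intro x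
      by_contra! hno
      refine x.2.2 ?_
      rw [stepDeriv_apply w t n (measurableSet_singleton _)]
      refine Finset.sum_eq_zero fun i hi => indicator_of_notMem (fun h => ?_) _
      exact hno i (Finset.mem_range.1 hi) h
    choose i hin hix using hex
    have hinj : Function.Injective i := fun x y hxy => Subtype.ext (by rw [← hix, ← hix, hxy])
    set f : ℕ → ℝ≥0∞ := fun k => if k < n then (K (nndist (w (t (k + 1))) (w (t k))) : ℝ≥0∞) else 0
      with hf
    calc ∑' x : A, (K ‖stepDeriv w t n {(x : ℝ)}‖₊ : ℝ≥0∞) = ∑' x : A, f (i x) := by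
          refine tsum_congr fun x => ?_
          simp only [hf]
          rw [if_pos (hin x), ← hix x, stepDeriv_singleton w hmono (hin x), nndist_eq_nnnorm]
      _ ≤ ∑' k, f k := ENNReal.tsum_comp_le_tsum_of_injective hinj f
      _ = ∑ k ∈ Finset.range n, f k := tsum_eq_sum fun k hk => if_neg (by simpa using hk)
      _ = ∑ k ∈ Finset.range n, (K (nndist (w (t (k + 1))) (w (t k))) : ℝ≥0∞) :=
          Finset.sum_congr rfl fun k hk => if_pos (Finset.mem_range.1 hk)
      _ ≤ kVar K w (Ioo a b) := eVariationOn.sum_le_of_monotoneOn_Iic (E := KLine K) (f := w)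
          (hmono.monotone.monotoneOn _) ht
  · intro B hB hBm
    rw [stepDeriv_apply w t n hBm]
    refine Finset.sum_eq_zero fun i hi => ?_
    by_cases h : t (i + 1) ∈ B
    · rw [indicator_of_mem h, ← stepDeriv_singleton w hmono (Finset.mem_range.1 hi)]
      by_contra hne
      exact (hB h).2 ⟨(hB h).1, hne⟩
    · exact indicator_of_notMem h _

theorem stepFun_eq (w : ℝ → ℝ) {t : ℕ → ℝ} (ht : Monotone t) (n : ℕ) (x : ℝ) :
    ∃ k ≤ n, stepFun w t n x = w (t k) ∧ (k = 0 ∨ t k ≤ x) ∧ (k = n ∨ x < t (k + 1)) := by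
  induction n with
  | zero => exact ⟨0, le_rfl, by simp [stepFun], Or.inl rfl, Or.inl rfl⟩
  | succ n ih =>
    obtain ⟨k, hk, h1, h2, h3⟩ := ih
    rw [stepFun_succ]
    by_cases h : t (n + 1) ≤ x
    · have hkn : k = n := h3.resolve_right fun h' =>
        absurd (h'.trans_le (ht (by omega : k + 1 ≤ n + 1))) (not_lt.2 h)
      subst hkn
      exact ⟨k + 1, le_rfl, by rw [h1, if_pos h]; ring, Or.inr h, Or.inl rfl⟩
    · refine ⟨k, by omega, by rw [h1, if_neg h, add_zero], h2, Or.inr ?_⟩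
      rcases h3 with rfl | h3
      · exact not_le.1 h
      · exact h3

/-- Any function is approximated by step functions without increasing the energy. -/
theorem exists_step_approx (K : ℝ≥0 → ℝ≥0) [IsCost K] (hab : a < b) (w : ℝ → ℝ) (n : ℕ) :
    ∃ v : ℝ → ℝ, Measurable v ∧ IsBV a b v ∧ TVK K a b v ≤ kVar K w (Ioo a b) ∧
      ∀ x ∈ Ioo a b, ∃ y ∈ Ioo a b, v x = w y ∧ |y - x| ≤ (b - a) / (n + 2) := by
  -- The `n + 1` nodes `a + h, …, b - h` stay inside the open interval, and every point of it is
  -- within `h` of the node whose value is sampled.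
  set h : ℝ := (b - a) / (n + 2) with hh
  have hpos : 0 < h := div_pos (sub_pos.2 hab) (by positivity)
  have hn : h * (n + 2) = b - a := by rw [hh]; field_simp
  set t : ℕ → ℝ := fun i => a + h * (i + 1) with ht
  have hmono : StrictMono t := strictMono_nat_of_lt_succ fun i => by
    simp only [ht]
    push_cast
    linarith
  have htab : ∀ i ≤ n, t i ∈ Ioo a b := by
    intro i hi
    have h1 : (i : ℝ) ≤ n := by exact_mod_cast hi
    constructor
    · simp only [ht]
      have : 0 < h * (i + 1) := by positivity
      linarith
    · simp only [ht]
      nlinarith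
  refine ⟨stepFun w t n, measurable_stepFun w t n, ⟨stepFun_integrableOn w t n,
    ⟨_, hasDistribDeriv_stepFun w htab⟩⟩, TVK_stepFun_le K hab w hmono htab, fun x hx => ?_⟩
  obtain ⟨k, hk, h1, h2, h3⟩ := stepFun_eq w hmono.monotone n x
  refine ⟨t k, htab k hk, h1, ?_⟩
  have h4 : t k - x ≤ h := by
    rcases h2 with rfl | h2
    · simp only [ht]
      push_cast
      linarith [hx.1]
    · linarith
  have h5 : x - t k ≤ h := by
    have e : t (k + 1) = t k + h := by
      simp only [ht]
      push_cast
      ring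
    rcases h3 with rfl | h3
    · have : t k + h = b := by
        simp only [ht]
        linarith
      linarith [hx.2]
    · linarith
  exact abs_le.2 ⟨by linarith, h4⟩

/-! ### From minimizers over `BV` to the reduced problem -/

theorem Tame.fidelity_eq {w g : ℝ → ℝ} (h : Tame a b w) (hg : ContinuousOn g (Icc a b)) {lam : ℝ}
    (hlam : 0 < lam) : fidelity lam g a b w =
      ENNReal.ofReal (lam / 2 * ∫ x in Ioo a b, (w x - g x) ^ 2) := by
  rw [fidelity, ENNReal.ofReal_mul (by positivity), ofReal_integral_eq_lintegral_ofReal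
    (h.sub_sq_integrableOn hg) (ae_of_all _ fun x => sq_nonneg _)]
  simp_rw [sq_abs]

/-- Minimizers of the energy over `BV` have at most the energy of any tame function, the latter
being measured with the `K`-variation. -/
theorem IsMinimizer.le_kVar_add {K : ℝ≥0 → ℝ≥0} [IsCost K] {lam : ℝ} {g U w : ℝ → ℝ}
    (hU : IsMinimizer K lam g a b U) (hab : a < b) (hg : ContinuousOn g (Icc a b))
    (hw : Tame a b w) :
    TVKg K lam g a b U ≤ kVar K w (Ioo a b) + fidelity lam g a b w := by
  choose v hvm hvBV hvK hv using exists_step_approx K hab w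
  obtain ⟨B, hB⟩ := hw.bdd
  obtain ⟨G, hG⟩ := isCompact_Icc.exists_bound_of_continuousOn hg
  have hgm : AEMeasurable g (volume.restrict (Ioo a b)) :=
    (hg.mono Ioo_subset_Icc_self).aemeasurable measurableSet_Ioo
  have hlim : Tendsto (fun n => ∫⁻ x in Ioo a b, ENNReal.ofReal (|v n x - g x| ^ 2)) atTop
      (𝓝 (∫⁻ x in Ioo a b, ENNReal.ofReal (|w x - g x| ^ 2))) := by
    refine tendsto_lintegral_of_dominated_convergence'
      (fun _ => ENNReal.ofReal ((B + G) ^ 2)) (fun n => ?_) (fun n => ?_) ?_ ?_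
    · simp_rw [sq_abs]
      exact (((hvm n).aemeasurable.sub hgm).pow_const 2).ennreal_ofReal
    · refine (ae_restrict_iff' measurableSet_Ioo).2 (Eventually.of_forall fun x hx => ?_)
      obtain ⟨y, hy, e, -⟩ := hv n x hx
      have h1 := hB y hy
      have h2 := hG x (Ioo_subset_Icc_self hx)
      rw [Real.norm_eq_abs] at h2
      beta_reduce
      rw [e]
      exact ENNReal.ofReal_le_ofReal (pow_le_pow_left₀ (abs_nonneg _)
        ((abs_sub _ _).trans (add_le_add h1 h2)) 2)
    · rw [lintegral_const]
      exact ENNReal.mul_ne_top ENNReal.ofReal_ne_top (by simp)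
    · refine (ae_restrict_iff' measurableSet_Ioo).2 ?_
      -- The sampled values converge at continuity points of `w`, that is, off a countable set.
      filter_upwards [hw.countable.ae_notMem volume] with x hx hxs
      have hc : ContinuousAt w x := by
        by_contra hn
        exact hx ⟨hxs, hn⟩
      choose y _ hye hyd using fun n => hv n x hxs
      have hy : Tendsto y atTop (𝓝 x) := by
        rw [tendsto_iff_dist_tendsto_zero]
        refine squeeze_zero (fun n => dist_nonneg) hyd ?_
        exact tendsto_const_nhds.div_atTop
          (tendsto_atTop_add_const_right _ _ tendsto_natCast_atTop_atTop)
      have hvx : Tendsto (fun n => v n x) atTop (𝓝 (w x)) := by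
        simp_rw [hye]
        exact hc.tendsto.comp hy
      exact ENNReal.tendsto_ofReal (((hvx.sub_const (g x)).abs).pow 2)
  have hlim' : Tendsto (fun n => kVar K w (Ioo a b) + fidelity lam g a b (v n)) atTop
      (𝓝 (kVar K w (Ioo a b) + fidelity lam g a b w)) :=
    (ENNReal.Tendsto.const_mul hlim (Or.inr ENNReal.ofReal_ne_top)).const_add _
  exact ge_of_tendsto' hlim' fun n => (hU.le _ (hvBV n)).trans (add_le_add (hvK n) le_rfl)

/-- Chain `kVar u + F u ≤ TVKg U ≤ kVar w + F w`, where `F` is the fidelity: the first inequality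
concerns the representative, the second comes from step approximation. No equality of `kVar u` and
`TVK U` is required. -/
theorem IsMinimizer.exists_isTameMinimizer {K : ℝ≥0 → ℝ≥0} [IsCost K] {lam : ℝ} {g U : ℝ → ℝ}
    (hU : IsMinimizer K lam g a b U) (hab : a < b) (hlam : 0 < lam)
    (hg : ContinuousOn g (Icc a b)) :
    ∃ u : ℝ → ℝ, (∀ᵐ x, x ∈ Ioo a b → U x = u x) ∧ IsTameMinimizer K lam g a b u ∧
      jumpSet a b U = {x ∈ Ioo a b | ¬ContinuousAt u x} := by
  obtain ⟨hUi, μ, hμ⟩ := hU.isBV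
  obtain ⟨c, hrep⟩ := hμ.exists_ae_eq hab hUi
  set u : ℝ → ℝ := fun x => c + μ (Iic x) with hu
  have htame : Tame a b u := tame_rep a b c μ
  have hle := hμ.kVar_le_TVK (K := K) hab hUi c
  have hfid : fidelity lam g a b U = fidelity lam g a b u := by
    unfold fidelity
    congr 1
    refine lintegral_congr_ae ((ae_restrict_iff' measurableSet_Ioo).2 ?_)
    filter_upwards [hrep] with x hx hxs
    rw [hx hxs]
  refine ⟨u, hrep, ⟨htame, fun x _ => (tendsto_Iic_right μ x).const_add c, ?_, fun w hw => ?_⟩, ?_⟩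
  -- Comparison with the zero function bounds the energy of `U`, hence the variation of `u`.
  · have h0 : Tame a b fun _ => 0 :=
      ⟨⟨0, fun x _ => by simp⟩, by simp [continuousAt_const]⟩
    have h1 := hU.le_kVar_add hab hg h0
    rw [h0.fidelity_eq hg hlam] at h1
    have h2 : kVar K (fun _ => 0) (Ioo a b) ≤ 0 := kVar_le fun n p _ _ => by
      simp [IsCost.zero (K := K)]
    refine ne_top_of_le_ne_top ?_ (hle.trans (le_self_add.trans h1))
    exact ENNReal.add_ne_top.2 ⟨ne_top_of_le_ne_top ENNReal.zero_ne_top h2, ENNReal.ofReal_ne_top⟩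
  · rw [← htame.fidelity_eq hg hlam, ← hw.fidelity_eq hg hlam, ← hfid]
    exact (add_le_add hle le_rfl).trans (hU.le_kVar_add hab hg hw)
  · rw [jumpSet_eq hUi hrep]
    ext x
    exact and_congr_right fun _ => not_congr continuousAt_rep_iff.symm

theorem IsPiecewiseConstant.neg {v : ℝ → ℝ} (h : IsPiecewiseConstant a b v) :
    IsPiecewiseConstant a b fun x => -v x := by
  obtain ⟨n, t, c, ht, h0, h1, hc⟩ := h
  exact ⟨n, t, fun i => -c i, ht, h0, h1, fun i x hx => congrArg Neg.neg (hc i x hx)⟩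

end KWC
end
-- The theorem for monotone data of either direction
theorem mainTheorem1 (K : ℝ≥0 → ℝ≥0) (hK1 : KWC.CondK1 K) (hK2 : KWC.CondK2 K)
    (hK3 : KWC.CondK3 K) (a b lam : ℝ) (hab : a < b) (hlam : 0 < lam)
    (g : ℝ → ℝ) (hg : ContinuousOn g (Icc a b))
    (M C : ℝ≥0) (hM : 0 < M) (hgM : |g b - g a| ≤ M) (hC : 0 < C) (hCM : KWC.IneqK2 K M C)
    (U : ℝ → ℝ) (hU : KWC.IsMinimizer K lam g a b U) :
    (MonotoneOn g (Icc a b) →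
      (∃ v : ℝ → ℝ, U =ᵐ[volume.restrict (Ioo a b)] v ∧ KWC.IsPiecewiseConstant a b v ∧
        MonotoneOn v (Icc a b) ∧
        ∀ x ∈ Icc a b, sInf (g '' Icc a b) ≤ v x ∧ v x ≤ sSup (g '' Icc a b)) ∧
      (KWC.jumpSet a b U).encard ≤ ((⌊(b - a) * lam / (2 * (C : ℝ))⌋₊ + 1 : ℕ) : ℕ∞)) ∧
    (AntitoneOn g (Icc a b) →
      (∃ v : ℝ → ℝ, U =ᵐ[volume.restrict (Ioo a b)] v ∧ KWC.IsPiecewiseConstant a b v ∧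
        AntitoneOn v (Icc a b) ∧
        ∀ x ∈ Icc a b, sInf (g '' Icc a b) ≤ v x ∧ v x ≤ sSup (g '' Icc a b)) ∧
      (KWC.jumpSet a b U).encard ≤ ((⌊(b - a) * lam / (2 * (C : ℝ))⌋₊ + 1 : ℕ) : ℕ∞)) := by
  have := KWC.IsCost.of_cond hK1 hK2 hK3
  obtain ⟨u, hUu, hu, hJ⟩ := hU.exists_isTameMinimizer hab hlam hg
  have ha : a ∈ Icc a b := left_mem_Icc.2 hab.le
  have hb : b ∈ Icc a b := right_mem_Icc.2 hab.le
  have hinf : ∀ x ∈ Icc a b, sInf (g '' Icc a b) ≤ g x := fun x hx =>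
    csInf_le (isCompact_Icc.bddBelow_image hg) (mem_image_of_mem g hx)
  have hsup : ∀ x ∈ Icc a b, g x ≤ sSup (g '' Icc a b) := fun x hx =>
    le_csSup (isCompact_Icc.bddAbove_image hg) (mem_image_of_mem g hx)
  have hae : ∀ v : ℝ → ℝ, EqOn v u (Ioo a b) → U =ᵐ[volume.restrict (Ioo a b)] v := by
    intro v hv
    refine (ae_restrict_iff' measurableSet_Ioo).2 ?_
    filter_upwards [hUu] with x hx hxs
    rw [hx hxs, hv hxs]
  rw [hJ]
  refine ⟨fun hmono => ?_, fun hanti => ?_⟩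
  · obtain ⟨⟨v, hv, hpc, hvm, hvr⟩, hcard⟩ := hu.structure_of_monotoneOn hlam hab hg hmono
      ((le_abs_self _).trans hgM) hC hCM
    exact ⟨⟨v, hae v hv, hpc, hvm, fun x hx =>
      ⟨(hinf a ha).trans (hvr x hx).1, (hvr x hx).2.trans (hsup b hb)⟩⟩, hcard⟩
  -- Negating `u` and `g` preserves the reduced problem and the discontinuity set, and exchanges the
  -- two directions of monotonicity.
  · obtain ⟨⟨v, hv, hpc, hvm, hvr⟩, hcard⟩ := hu.neg.structure_of_monotoneOn hlam hab hg.neg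
      (fun x hx y hy hxy => neg_le_neg (hanti hx hy hxy))
      (by rw [neg_sub_neg, ← neg_sub]; exact (neg_le_abs _).trans hgM) hC hCM
    refine ⟨⟨fun x => -v x, hae _ fun x hx => ?_, hpc.neg, fun x hx y hy hxy =>
      neg_le_neg (hvm hx hy hxy), fun x hx => ⟨(hinf b hb).trans ?_, le_trans ?_ (hsup a ha)⟩⟩, ?_⟩
    · rw [hv hx, neg_neg]
    · exact le_neg_of_le_neg (hvr x hx).2
    · exact neg_le_of_neg_le (hvr x hx).1
    · have e : ∀ x, ContinuousAt (fun y => -u y) x ↔ ContinuousAt u x := fun x =>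
        ⟨fun h => h.neg.congr (Eventually.of_forall fun y => neg_neg (u y)), fun h => h.neg⟩
      simpa only [e] using hcard
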